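/- **Setting.** There are two fuels, $I=\{c,g\}$. For $i\in I$ write $j$ for the other fuel, and let $k_i\in\mathbb R$, $m_i>0$ and a capacity $\bar\xi^i>0$ be given; put $\bar\xi=\bar\xi^c+\bar\xi^g$ and $b_i(\xi,s)=s\,e^{k_i+m_i\xi}$. The inverse of the fuel bid curve is $$\hat b_i^{-1}(p,s)=\bar\xi^i\wedge\inf\{\xi\in(0,\bar\xi^i]: b_i(\xi,s)>p\},$$ and the market bid stack is $$b(\xi,\mathbf s)=\min_{i\in I} b_i(0,s^i)\ \vee\ \sup\Big\{p\in\mathbb R:\ \sum_{i\in I}\hat b_i^{-1}(p,s^i)<\xi\Big\}$$ (with $\inf\varnothing=+\infty$, $\sup\varnothing=-\infty$). Let $i_+$ be a fuel of largest capacity (either one in case of a tie). Let $(\Omega,\mathcal F,(\mathcal F_t)_{t\ge 0},\mathbb Q)$ be a filtered probability space ($\mathbb Q$ is the pricing measure), let $0\le t\le T$, let the fuel prices $S^c,S^g$, the demand $D$ and the process $X$ be adapted, with $S^i_T>0$ almost surely and $S^i_T$ integrable. The electricity spot price is $P=b(D,S^c,S^g)$, its forward price is $F^p_t=\mathbb E^{\mathbb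 Q}[P_T\mid\mathcal F_t]$, and the fuel forward prices are $F^i_t=\mathbb E^{\mathbb Q}[S^i_T\mid\mathcal F_t]$, $\mathbf F_t=(F^c_t,F^g_t)$. Assume that $D_T=\max(0,\min(\bar\xi,X_T))$ almost surely and that, under $\mathbb Q$ and conditionally on $\mathcal F_t$, - $(\log S^c_T,\log S^g_T)$ is bivariate normal with means $\mu_c,\mu_g$, variances $\sigma_c^2,\sigma_g^2$ and correlation $\rho$, - $X_T\sim N(\mu_d,\sigma_d^2)$, - $X_T$ is independent of $(S^c_T,S^g_T)$, where $\mu_c,\mu_g,\mu_d$ are $\mathcal F_t$-measurable (for instance constants), $\sigma_c,\sigma_g\ge0$, $\rho\in[-1,1]$ and $\sigma_d>0$ are constants, and $\sigma>0$, where $\sigma^2=\sigma_c^2-2\rho\sigma_c\sigma_g+\sigma_g^2$. **Notation.** $\Phi_1$ is the standard normal cdf, $\Phi_2(\cdot,\cdot;\rho)$ the bivariate standard normal cdf with correlation $\rho$, and $\Phi_2^{2\times1}\left(\left[\begin{smallmatrix}x_1\\x_2\end{smallmatrix}\right],y;\rho\right)=\Phi_2(x_1,y;\rho)-\Phi_2(x_2,y;\rho)$.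 Further $$\alpha_c=\frac{m_g}{m_c+m_g},\quad \alpha_g=\frac{m_c}{m_c+m_g},\quad \beta=\frac{k_cm_g+k_gm_c}{m_c+m_g},\quad \gamma=\frac{m_cm_g}{m_c+m_g},$$ $$b_{cg}(\xi,\mathbf x)=(x^c)^{\alpha_c}(x^g)^{\alpha_g}e^{\beta+\gamma\xi},\qquad R_i(\xi_i,\xi_j)=k_j+m_j\xi_j-k_i-m_i\xi_i+\log F^j_t-\log F^i_t-\tfrac12\sigma^2,$$ $$\delta_{i}=-1 \text{ if } i=i_+,\quad \delta_i=1 \text{ otherwise},\qquad \sigma_{i,d}=\sqrt{m_i^2\sigma_d^2+\sigma^2},\qquad \eta=\tfrac12\left(\gamma^2\sigma_d^2-\alpha_c\alpha_g\sigma^2\right).$$ **Claim.** $P_T$ is integrable and, almost surely, $$\begin{aligned} F_t^p={}&\sum_{i\in I} e^{m_i^2\sigma_d^2/2}\Big\{b_i(\mu_d,F_t^i)\,\Phi_2^{2\times 1}\Big(\Big[\begin{smallmatrix}\frac{\bar\xi^i-\mu_d}{\sigma_d}-m_i\sigma_d\\ \frac{-\mu_d}{\sigma_d}-m_i\sigma_d\end{smallmatrix}\Big],\tfrac{R_i(\mu_d,0)-m_i^2\sigma_d^2}{\sigma_{i,d}};\tfrac{m_i\sigma_d}{\sigma_{i,d}}\Big)\\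 &\quad+b_i(\mu_d-\bar\xi^j,F^i_t)\,\Phi_2^{2\times 1}\Big(\Big[\begin{smallmatrix}\frac{\bar\xi-\mu_d}{\sigma_d}-m_i\sigma_d\\ \frac{\bar\xi^j-\mu_d}{\sigma_d}-m_i\sigma_d\end{smallmatrix}\Big],\tfrac{-R_i(\mu_d-\bar\xi^j,\bar\xi^j)+m_i^2\sigma_d^2}{\sigma_{i,d}};\tfrac{-m_i\sigma_d}{\sigma_{i,d}}\Big)\Big\}\\ &+\sum_{i\in I}\delta_i e^{\eta}\,b_{cg}(\mu_d,\mathbf F_t)\Big\{-\Phi_2^{2\times 1}\Big(\Big[\begin{smallmatrix}\frac{\bar\xi^i-\mu_d}{\sigma_d}-\gamma\sigma_d\\ \frac{-\mu_d}{\sigma_d}-\gamma\sigma_d\end{smallmatrix}\Big],\tfrac{R_i(\mu_d,0)+\alpha_j\sigma^2-\gamma m_i\sigma_d^2}{\delta_i\sigma_{i,d}};\tfrac{m_i\sigma_d}{\delta_i\sigma_{i,d}}\Big)\\ &\quad+\Phi_2^{2\times 1}\Big(\Big[\begin{smallmatrix}\frac{\bar\xi-\mu_d}{\sigma_d}-\gamma\sigma_d\\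 \frac{\bar\xi^j-\mu_d}{\sigma_d}-\gamma\sigma_d\end{smallmatrix}\Big],\tfrac{R_i(\mu_d-\bar\xi^j,\bar\xi^j)+\alpha_j\sigma^2-\gamma m_i\sigma_d^2}{\delta_i\sigma_{i,d}};\tfrac{m_i\sigma_d}{\delta_i\sigma_{i,d}}\Big)\Big\}\\ &+\Phi_1\Big(\tfrac{-\mu_d}{\sigma_d}\Big)\sum_{i\in I} b_i(0,F^i_t)\,\Phi_1\Big(\tfrac{R_i(0,0)}{\sigma}\Big)+\Phi_1\Big(\tfrac{\mu_d-\bar\xi}{\sigma_d}\Big)\sum_{i\in I} b_i(\bar\xi^i,F^i_t)\,\Phi_1\Big(\tfrac{-R_i(\bar\xi^i,\bar\xi^j)}{\sigma}\Big). \end{aligned}$$ -/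

import Mathlib

open MeasureTheory ProbabilityTheory
open scoped NNReal

noncomputable section

namespace BidStack

/-! ### The market bid stack -/

/-- The generalized (right continuous) inverse at the price `p` of a fuel bid curve
`β : [0, cap] → ℝ`, that is `cap ∧ inf {ξ ∈ (0, cap] | β ξ > p}` with `inf ∅ = +∞`.
(The real infimum is taken over the set with `cap` adjoined, which is exactly this minimum.) -/
def bidInverse (β : ℝ → ℝ) (cap p : ℝ) : ℝ :=
  sInf (insert cap {ξ | ξ ∈ Set.Ioc 0 cap ∧ p < β ξ})

/-- The market bid stack at supply `ξ` built by merit order from the fuel bid curves `b i` with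
capacities `cap i`, that is `minᵢ bᵢ(0) ∨ sup {p | ∑ᵢ bᵢ⁻¹(p) < ξ}` with `sup ∅ = -∞`.
(The real supremum is taken over the set with `minᵢ bᵢ(0)` adjoined, which is exactly this
maximum.) -/
def marketBid {ι : Type*} [Fintype ι] (b : ι → ℝ → ℝ) (cap : ι → ℝ) (ξ : ℝ) : ℝ :=
  sSup (insert (⨅ i, b i 0) {p | ∑ i, bidInverse (b i) (cap i) p < ξ})

/-- Parameters of an exponential bid stack with two fuels: `0` is coal and `1` is gas. For the
fuel `i`, `i.rev` is the other one. -/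
structure Stack where
  /-- The constants `kᵢ`. -/
  k : Fin 2 → ℝ
  /-- The constants `mᵢ`. -/
  m : Fin 2 → ℝ
  /-- The capacity of the generators that use fuel `i`. -/
  cap : Fin 2 → ℝ
  m_pos : ∀ i, 0 < m i
  cap_pos : ∀ i, 0 < cap i

namespace Stack

variable (A : Stack)

/-- The market capacity. -/
def totalCap : ℝ := ∑ i, A.cap i

/-- The exponential fuel bid curve `bᵢ(ξ, s) = s exp(kᵢ + mᵢ ξ)`. -/
def bid (i : Fin 2) (ξ s : ℝ) : ℝ := s * Real.exp (A.k i + A.m i * ξ)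

/-- The market bid stack `b(ξ, s)` of the two exponential fuel bid curves. -/
def price (ξ : ℝ) (s : Fin 2 → ℝ) : ℝ := marketBid (fun i x => A.bid i x (s i)) A.cap ξ

/-! ### The closed form -/

/-- `α_c = m_g / (m_c + m_g)` and `α_g = m_c / (m_c + m_g)`. -/
def alpha (i : Fin 2) : ℝ := A.m i.rev / (A.m 0 + A.m 1)

def beta : ℝ := (A.k 0 * A.m 1 + A.k 1 * A.m 0) / (A.m 0 + A.m 1)

def gamma : ℝ := A.m 0 * A.m 1 / (A.m 0 + A.m 1)

/-- `b_cg(ξ, s) = s_c ^ α_c * s_g ^ α_g * exp (β + γ ξ)`. -/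
def bidBoth (ξ : ℝ) (s : Fin 2 → ℝ) : ℝ :=
  s 0 ^ A.alpha 0 * s 1 ^ A.alpha 1 * Real.exp (A.beta + A.gamma * ξ)

/-- `Rᵢ(ξᵢ, ξⱼ)` at the fuel forward prices `F`, where `j` is the fuel other than `i`. -/
def R (σ : ℝ) (F : Fin 2 → ℝ) (i : Fin 2) (x y : ℝ) : ℝ :=
  A.k i.rev + A.m i.rev * y - A.k i - A.m i * x + Real.log (F i.rev) - Real.log (F i) - σ ^ 2 / 2

/-- `σ_{i,d}`, the positive root of `mᵢ² σ_d² + σ²`. -/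
def sigmaD (σ σd : ℝ) (i : Fin 2) : ℝ := √(A.m i ^ 2 * σd ^ 2 + σ ^ 2)

def eta (σ σd : ℝ) : ℝ := (A.gamma ^ 2 * σd ^ 2 - A.alpha 0 * A.alpha 1 * σ ^ 2) / 2

end Stack

/-- The standard normal cdf. -/
def Phi1 (x : ℝ) : ℝ := cdf (gaussianReal 0 1) x

/-- The cdf at `(x, y)` of the bivariate standard normal law with correlation `ρ`. -/
def Phi2 (x y ρ : ℝ) : ℝ :=
  (multivariateGaussian (0 : EuclideanSpace ℝ (Fin 2)) !![1, ρ; ρ, 1]).real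
    {z | z 0 ≤ x ∧ z 1 ≤ y}

/-- `Φ₂` differenced in its first argument. -/
def Phi2Diff (x₁ x₂ y ρ : ℝ) : ℝ := Phi2 x₁ y ρ - Phi2 x₂ y ρ

/-- The closed form of the electricity forward price for clipped Gaussian demand, as a function
of the fuel forward prices `F`. The fuel with the larger capacity is `iplus`. -/
def Stack.forward (A : Stack) (iplus : Fin 2) (σ μd σd : ℝ) (F : Fin 2 → ℝ) : ℝ :=
  let ξ := A.totalCap
  let δ : Fin 2 → ℝ := fun i => if i = iplus then -1 else 1
  (∑ i, Real.exp (A.m i ^ 2 * σd ^ 2 / 2) *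
    (A.bid i μd (F i) *
        Phi2Diff ((A.cap i - μd) / σd - A.m i * σd) (-μd / σd - A.m i * σd)
          ((A.R σ F i μd 0 - A.m i ^ 2 * σd ^ 2) / A.sigmaD σ σd i)
          (A.m i * σd / A.sigmaD σ σd i)
      + A.bid i (μd - A.cap i.rev) (F i) *
        Phi2Diff ((ξ - μd) / σd - A.m i * σd) ((A.cap i.rev - μd) / σd - A.m i * σd)
          ((-A.R σ F i (μd - A.cap i.rev) (A.cap i.rev) + A.m i ^ 2 * σd ^ 2) / A.sigmaD σ σd i)
          (-(A.m i * σd) / A.sigmaD σ σd i)))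
  + (∑ i, δ i * Real.exp (A.eta σ σd) * A.bidBoth μd F *
    (-Phi2Diff ((A.cap i - μd) / σd - A.gamma * σd) (-μd / σd - A.gamma * σd)
          ((A.R σ F i μd 0 + A.alpha i.rev * σ ^ 2 - A.gamma * A.m i * σd ^ 2)
            / (δ i * A.sigmaD σ σd i))
          (A.m i * σd / (δ i * A.sigmaD σ σd i))
      + Phi2Diff ((ξ - μd) / σd - A.gamma * σd) ((A.cap i.rev - μd) / σd - A.gamma * σd)
          ((A.R σ F i (μd - A.cap i.rev) (A.cap i.rev) + A.alpha i.rev * σ ^ 2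
            - A.gamma * A.m i * σd ^ 2) / (δ i * A.sigmaD σ σd i))
          (A.m i * σd / (δ i * A.sigmaD σ σd i))))
  + Phi1 (-μd / σd) * ∑ i, A.bid i 0 (F i) * Phi1 (A.R σ F i 0 0 / σ)
  + Phi1 ((μd - ξ) / σd) *
      ∑ i, A.bid i (A.cap i) (F i) * Phi1 (-A.R σ F i (A.cap i) (A.cap i.rev) / σ)

/-! ### Conditional laws -/

/-- The random measure `ν` is the conditional law of `Y` given the σ-algebra `m`: for every
measurable set `B`, `Q(Y ∈ B | m) = ν(B)` almost surely. -/
def HasCondLaw {Ω E : Type*} {mΩ : MeasurableSpace Ω} [MeasurableSpace E] (Q : Measure Ω)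
    (m : MeasurableSpace Ω) (Y : Ω → E) (ν : Ω → Measure E) : Prop :=
  ∀ B : Set E, MeasurableSet B → Q⟦Y ⁻¹' B | m⟧ =ᵐ[Q] fun ω => (ν ω).real B

/-- The bivariate normal law with means `μ`, standard deviations `s` and correlation `ρ`. -/
def bivariateNormal (μ s : Fin 2 → ℝ) (ρ : ℝ) : Measure (EuclideanSpace ℝ (Fin 2)) :=
  multivariateGaussian (WithLp.toLp 2 μ)
    !![s 0 ^ 2, ρ * s 0 * s 1; ρ * s 0 * s 1, s 1 ^ 2]

end BidStack

end

/-! Merit order makes the price piecewise explicit. In terms of log fuel prices and demand, the log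
price is always one of finitely many affine functions: the log bid of one fuel, with the other idle
or at capacity, or the weighted mean `logBidBoth` when both fuels are marginal. The position of the
demand and the signs of differences of two log bids decide which. Off ties, `price_eq_priceFormula`
thus turns the price into a signed sum of exponentials of affine functions, each restricted to a
range of demand cut by a half plane.

By `exists_map_stdNormal₃_eq`, the conditional law is that of log prices `μ i + a i * z₁ + b * z₂`
and demand `μd + σd * z₃` with independent standard normal factors. The coefficient `b` is common to
both fuels, so bid comparisons involve only `z₁` and `z₃`. Completing the square trades an
exponential weight for a constant and a translation of the event
(`integral_exp_indicator_stdNormal`). The translated event has a Gaussian measure given by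
`Phi2Diff`, or by a product of two `Phi1` values when demand is clipped and no longer enters the
bids.

Ties are null because `σ > 0`. The price is integrable because it is at most the sum of the two
highest bids, which is linear in the fuel prices. `HasCondLaw.condExp_comp_ae_eq` turns conditional
expectations into integrals against the given law; applied to the fuel prices themselves it
identifies their forward prices with `meanFuel`, which eliminates `μ` from the answer. -/

noncomputable section

namespace BidStack

/-! ### Evaluation of the market bid stack -/

section Inverse

variable {β : ℝ → ℝ} {cap p x : ℝ}

lemma bddBelow_bidInverse (hcap : 0 ≤ cap) :
    BddBelow (insert cap {ξ | ξ ∈ Set.Ioc 0 cap ∧ p < β ξ}) := by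
  refine ⟨0, ?_⟩
  rintro y (rfl | ⟨hy, -⟩)
  · exact hcap
  · exact hy.1.le

lemma bidInverse_nonneg (hcap : 0 ≤ cap) : 0 ≤ bidInverse β cap p := by
  refine le_csInf (Set.insert_nonempty _ _) ?_
  rintro y (rfl | ⟨hy, -⟩)
  · exact hcap
  · exact hy.1.le

lemma bidInverse_le_cap (hcap : 0 ≤ cap) : bidInverse β cap p ≤ cap :=
  csInf_le (bddBelow_bidInverse hcap) (Set.mem_insert _ _)

lemma bidInverse_le_of_lt (hx : x ∈ Set.Ioc 0 cap) (h : p < β x) : bidInverse β cap p ≤ x :=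
  csInf_le (bddBelow_bidInverse (hx.1.le.trans hx.2)) (Set.mem_insert_of_mem _ ⟨hx, h⟩)

lemma le_bidInverse (hβ : StrictMono β) (hx : x ≤ cap) (h : β x ≤ p) : x ≤ bidInverse β cap p := by
  refine le_csInf (Set.insert_nonempty _ _) ?_
  rintro y (rfl | ⟨-, hy⟩)
  · exact hx
  · exact (hβ.lt_iff_lt.1 (h.trans_lt hy)).le

/-- By continuity some smaller amount already bids above `p`. This strictness is what makes the sum
of inverses fall strictly below the supply in `marketBid_eq`. -/
lemma bidInverse_lt (hc : Continuous β) (hx : x ∈ Set.Ioc 0 cap) (h : p < β x) :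
    bidInverse β cap p < x := by
  have h1 : ∀ᶠ y in nhdsWithin x (Set.Iio x), p < β y :=
    (hc.continuousAt.eventually_const_lt h).filter_mono nhdsWithin_le_nhds
  have h2 : ∀ᶠ y in nhdsWithin x (Set.Iio x), y ∈ Set.Ioo 0 x := Ioo_mem_nhdsLT hx.1
  obtain ⟨y, hy, hy0, hyx⟩ := (h1.and h2).exists
  exact (bidInverse_le_of_lt ⟨hy0, hyx.le.trans hx.2⟩ hy).trans_lt hyx

lemma bidInverse_eq_zero (hβ : StrictMono β) (hcap : 0 ≤ cap) (h : p < β 0) :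
    bidInverse β cap p = 0 := by
  refine le_antisymm (not_lt.1 fun hlt => ?_) (bidInverse_nonneg hcap)
  have hle := bidInverse_le_cap (β := β) (p := p) hcap
  -- The infimum runs over positive amounts only, so a positive infimum is refuted at half its value
  -- rather than at `0`.
  have := bidInverse_le_of_lt (β := β) (p := p) (cap := cap) (x := bidInverse β cap p / 2)
    ⟨by linarith, by linarith⟩ (h.trans (hβ (by linarith)))
  linarith

end Inverse

section Market

variable {ι : Type*} [Fintype ι] {b : ι → ℝ → ℝ} {cap : ι → ℝ}

lemma marketBid_of_nonpos (hcap : ∀ i, 0 ≤ cap i) {ξ : ℝ} (hξ : ξ ≤ 0) :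
    marketBid b cap ξ = ⨅ i, b i 0 := by
  have : {p | ∑ i, bidInverse (b i) (cap i) p < ξ} = ∅ := by
    ext p
    simp only [Set.mem_ofPred_eq, Set.mem_empty_iff_false, iff_false, not_lt]
    exact hξ.trans (Finset.sum_nonneg fun i _ => bidInverse_nonneg (hcap i))
  simp [marketBid, this]

/-- If the fuel `i` supplies `x i`, the price is `p` when no fuel can supply more at a lower bid
and one of them bids exactly `p` for its last unit. -/
lemma marketBid_eq (hc : ∀ i, Continuous (b i)) (hb : ∀ i, StrictMono (b i)) {x : ι → ℝ} {p : ℝ}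
    (hx : ∀ i, x i ∈ Set.Icc 0 (cap i)) (hle : ∀ i, p ≤ b i (x i) ∨ x i = cap i)
    (hge : ∀ i, b i (x i) ≤ p ∨ x i = 0) {j : ι} (hj : 0 < x j) (hjp : b j (x j) = p) :
    marketBid b cap (∑ i, x i) = p := by
  have hcap i : 0 ≤ cap i := (hx i).1.trans (hx i).2
  -- Below `p` no fuel offers more than its share, and the marginal fuel `j` offers strictly less.
  -- Above `p` every fuel offers at least its share. Hence `p` is the supremum.
  have hbelow : ∀ q < p, ∑ i, bidInverse (b i) (cap i) q < ∑ i, x i := by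
    intro q hq
    refine Finset.sum_lt_sum (fun i _ => ?_)
      ⟨j, Finset.mem_univ j, bidInverse_lt (hc j) ⟨hj, (hx j).2⟩ (hjp ▸ hq)⟩
    rcases hle i with h | h
    · rcases (hx i).1.eq_or_lt with h0 | h0
      · rw [← h0] at h ⊢
        exact (bidInverse_eq_zero (hb i) (hcap i) (hq.trans_le h)).le
      · exact bidInverse_le_of_lt ⟨h0, (hx i).2⟩ (hq.trans_le h)
    · exact (bidInverse_le_cap (hcap i)).trans_eq h.symm
  have habove : ∀ q, ∑ i, bidInverse (b i) (cap i) q < ∑ i, x i → q ≤ p := by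
    intro q hq
    by_contra! hpq
    refine hq.not_ge (Finset.sum_le_sum fun i _ => ?_)
    rcases hge i with h | h
    · exact le_bidInverse (hb i) (hx i).2 (h.trans hpq.le)
    · exact h.trans_le (bidInverse_nonneg (hcap i))
  refine IsLUB.csSup_eq ⟨?_, fun u hu => ?_⟩ (Set.insert_nonempty _ _)
  · rintro q (rfl | hq)
    · refine (ciInf_le (Set.finite_range _).bddBelow j).trans ?_
      exact hjp ▸ (hb j).monotone (hx j).1
    · exact habove q hq
  · by_contra! hup
    obtain ⟨q, huq, hqp⟩ := exists_between hup
    exact huq.not_ge (hu (Set.mem_insert_of_mem _ (hbelow q hqp)))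

end Market

/-! ### Two exponential fuels in logarithmic coordinates -/

namespace Stack

variable (A : Stack)

lemma sum_fin_two_rev {M : Type*} [AddCommMonoid M] (f : Fin 2 → M) (i : Fin 2) :
    ∑ l, f l = f i + f i.rev := by
  fin_cases i
  · simp [Fin.sum_univ_two, Fin.rev]
  · simp [Fin.sum_univ_two, Fin.rev, add_comm]

lemma eq_or_eq_rev (i l : Fin 2) : l = i ∨ l = i.rev := by
  revert i l; decide

lemma ne_rev (i : Fin 2) : i.rev ≠ i := by
  revert i; decide

/-- The logarithm of the bid at `x` of the fuel `i` when its log price is `y i`. -/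
def logBid (y : Fin 2 → ℝ) (i : Fin 2) (x : ℝ) : ℝ := y i + A.k i + A.m i * x

/-- The logarithm of `b_cg`, when the log fuel prices are `y`. -/
def logBidBoth (y : Fin 2 → ℝ) (x : ℝ) : ℝ :=
  A.alpha 0 * y 0 + A.alpha 1 * y 1 + A.beta + A.gamma * x

variable {A} {y : Fin 2 → ℝ}

lemma bid_exp (i : Fin 2) (x : ℝ) : A.bid i x (Real.exp (y i)) = Real.exp (A.logBid y i x) := by
  rw [bid, logBid, ← Real.exp_add, add_assoc]

lemma logBid_strictMono (i : Fin 2) : StrictMono (A.logBid y i) := fun _ _ h =>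
  add_lt_add_right (mul_lt_mul_of_pos_left h (A.m_pos i)) _

lemma alpha_add_alpha_rev (i : Fin 2) : A.alpha i + A.alpha i.rev = 1 := by
  have h0 := A.m_pos 0
  have h1 := A.m_pos 1
  fin_cases i <;> simp [alpha, Fin.rev] <;> field_simp <;> ring

/-- The weights are inversely proportional to the slopes, so moving supply from one fuel to the
other leaves the weighted mean of the log bids unchanged. -/
lemma alpha_mul_m (i : Fin 2) : A.alpha i * A.m i = A.gamma := by
  have h0 := A.m_pos 0
  have h1 := A.m_pos 1
  fin_cases i <;> simp [alpha, gamma, Fin.rev] <;> field_simp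

lemma alpha_mul_k (i : Fin 2) : A.alpha i * A.k i + A.alpha i.rev * A.k i.rev = A.beta := by
  have h0 := A.m_pos 0
  have h1 := A.m_pos 1
  fin_cases i <;> simp [alpha, beta, Fin.rev] <;> field_simp <;> ring

lemma alpha_pos (i : Fin 2) : 0 < A.alpha i :=
  div_pos (A.m_pos _) (add_pos (A.m_pos _) (A.m_pos _))

/-- At any split of the supply, `log b_cg` is the same weighted mean of the two log bids. -/
lemma logBidBoth_eq (i : Fin 2) (x t : ℝ) :
    A.logBidBoth y x = A.alpha i * A.logBid y i (x - t) + A.alpha i.rev * A.logBid y i.rev t := by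
  have h1 := A.alpha_mul_m i
  have h2 := A.alpha_mul_m i.rev
  have h3 := A.alpha_mul_k i
  have h4 : A.alpha 0 * y 0 + A.alpha 1 * y 1 = A.alpha i * y i + A.alpha i.rev * y i.rev := by
    rw [← sum_fin_two_rev (fun i => A.alpha i * y i) i, Fin.sum_univ_two]
  rw [logBidBoth, logBid, logBid, h4, ← h3]
  linear_combination -(x - t) * h1 - t * h2

lemma price_eq {i : Fin 2} {p u v : ℝ} (hu : u ∈ Set.Icc 0 (A.cap i))
    (hv : v ∈ Set.Icc 0 (A.cap i.rev))
    (hu1 : p ≤ A.logBid y i u ∨ u = A.cap i) (hv1 : p ≤ A.logBid y i.rev v ∨ v = A.cap i.rev)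
    (hu2 : A.logBid y i u ≤ p ∨ u = 0) (hv2 : A.logBid y i.rev v ≤ p ∨ v = 0)
    (h : 0 < u ∧ A.logBid y i u = p ∨ 0 < v ∧ A.logBid y i.rev v = p) :
    A.price (u + v) (fun i => Real.exp (y i)) = Real.exp p := by
  set x : Fin 2 → ℝ := fun l => if l = i then u else v with hx
  have hxi : x i = u := by simp [hx]
  have hxj : x i.rev = v := by simp [hx, ne_rev]
  have key : ∀ P : Fin 2 → ℝ → Prop, P i u → P i.rev v → ∀ l, P l (x l) := by
    intro P h1 h2 l
    rcases eq_or_eq_rev i l with rfl | rfl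
    · rwa [hxi]
    · rwa [hxj]
  have hsum : u + v = ∑ l, x l := by rw [sum_fin_two_rev x i, hxi, hxj]
  rw [price, hsum]
  obtain ⟨j, hj, hjp⟩ : ∃ j, 0 < x j ∧ A.logBid y j (x j) = p := by
    rcases h with h | h
    · exact ⟨i, by rwa [hxi]⟩
    · exact ⟨i.rev, by rwa [hxj]⟩
  simp only [bid_exp]
  refine marketBid_eq (b := fun l z => Real.exp (A.logBid y l z)) (x := x) (fun i => ?_)
    (fun i => Real.exp_strictMono.comp (logBid_strictMono i))
    (key (fun l z => z ∈ Set.Icc 0 (A.cap l)) hu hv) ?_ ?_ hj (by rw [hjp])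
  · unfold logBid; fun_prop
  · simp only [Real.exp_le_exp]
    exact key (fun l z => p ≤ A.logBid y l z ∨ z = A.cap l) hu1 hv1
  · simp only [Real.exp_le_exp]
    exact key (fun l z => A.logBid y l z ≤ p ∨ z = 0) hu2 hv2

/-- The fuel `i` alone sets the price, and the other one does not run. -/
lemma price_eq_low {i : Fin 2} {x : ℝ} (hx : x ∈ Set.Ioc 0 (A.cap i))
    (h : A.logBid y i x ≤ A.logBid y i.rev 0) :
    A.price x (fun i => Real.exp (y i)) = Real.exp (A.logBid y i x) := by
  have := price_eq (A := A) (y := y) (i := i) (p := A.logBid y i x) (u := x) (v := 0)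
    ⟨hx.1.le, hx.2⟩ ⟨le_rfl, (A.cap_pos _).le⟩ (.inl le_rfl) (.inl h) (.inl le_rfl) (.inr rfl)
    (.inl ⟨hx.1, rfl⟩)
  rwa [add_zero] at this

/-- The fuel `i` alone sets the price, and the other one runs at capacity. -/
lemma price_eq_high {i : Fin 2} {x : ℝ} (hx : A.cap i.rev < x) (hx' : x ≤ A.cap i + A.cap i.rev)
    (h : A.logBid y i.rev (A.cap i.rev) ≤ A.logBid y i (x - A.cap i.rev)) :
    A.price x (fun i => Real.exp (y i)) = Real.exp (A.logBid y i (x - A.cap i.rev)) := by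
  have := price_eq (A := A) (y := y) (i := i) (p := A.logBid y i (x - A.cap i.rev))
    (u := x - A.cap i.rev) (v := A.cap i.rev) ⟨by linarith, by linarith⟩
    ⟨(A.cap_pos _).le, le_rfl⟩ (.inl le_rfl) (.inr rfl) (.inl le_rfl) (.inl h)
    (.inl ⟨by linarith, rfl⟩)
  rwa [sub_add_cancel] at this

/-- Both fuels set the price. -/
lemma price_eq_both {i : Fin 2} {x t₀ t₁ : ℝ} (hx : 0 < x) (ht₀ : 0 ≤ t₀) (ht₁ : t₁ ≤ A.cap i.rev)
    (hxt₀ : x - t₀ ≤ A.cap i) (hxt₁ : 0 ≤ x - t₁)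
    (h₀ : A.logBid y i.rev t₀ ≤ A.logBid y i (x - t₀))
    (h₁ : A.logBid y i (x - t₁) ≤ A.logBid y i.rev t₁) :
    A.price x (fun i => Real.exp (y i)) = Real.exp (A.logBidBoth y x) := by
  set c := A.logBidBoth y x with hc
  -- The supply at which the fuel `i.rev` bids exactly `exp c`. Since `c` is the weighted mean of
  -- the two log bids at any split, the fuel `i` then bids `exp c` at `x - v`.
  set v := (c - y i.rev - A.k i.rev) / A.m i.rev with hv
  have ha := alpha_add_alpha_rev (A := A) i
  have hai := A.alpha_pos i
  have haj := A.alpha_pos i.rev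
  have hvc : A.logBid y i.rev v = c := by
    have := (A.m_pos i.rev).ne'
    rw [logBid, hv]; field_simp; ring
  have huc : A.logBid y i (x - v) = c := by
    have := logBidBoth_eq (A := A) (y := y) i x v
    rw [hvc, ← hc] at this
    have h2 : A.alpha i * (A.logBid y i (x - v) - c) = 0 := by linear_combination -this - c * ha
    rcases mul_eq_zero.1 h2 with h | h
    · exact absurd h hai.ne'
    · linarith
  -- Giving more supply to `i.rev` raises its bid and lowers that of `i`, so the signs of the bid
  -- gap at `t₀` and `t₁` bracket the crossing point `v`.
  have htv : t₀ ≤ v := by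
    by_contra! hlt
    have e1 := logBid_strictMono (A := A) (y := y) i.rev hlt
    have e2 := logBid_strictMono (A := A) (y := y) i (sub_lt_sub_left hlt x)
    linarith
  have hvt : v ≤ t₁ := by
    by_contra! hlt
    have e1 := logBid_strictMono (A := A) (y := y) i.rev hlt
    have e2 := logBid_strictMono (A := A) (y := y) i (sub_lt_sub_left hlt x)
    linarith
  have := price_eq (A := A) (y := y) (i := i) (p := c) (u := x - v) (v := v)
    ⟨by linarith, by linarith⟩ ⟨by linarith, by linarith⟩ (.inl huc.ge) (.inl hvc.ge) (.inl huc.le)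
    (.inl hvc.le) (by
      rcases (ht₀.trans htv).eq_or_lt with h | h
      · exact .inl ⟨by linarith, huc⟩
      · exact .inr ⟨h, hvc⟩)
  rwa [sub_add_cancel] at this

lemma price_eq_of_nonpos {x : ℝ} (hx : x ≤ 0) {i : Fin 2}
    (h : A.logBid y i 0 ≤ A.logBid y i.rev 0) :
    A.price x (fun i => Real.exp (y i)) = Real.exp (A.logBid y i 0) := by
  rw [price, marketBid_of_nonpos (fun i => (A.cap_pos i).le) hx]
  simp only [bid_exp]
  refine le_antisymm (ciInf_le (Set.finite_range _).bddBelow i) (le_ciInf fun l => ?_)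
  rcases eq_or_eq_rev i l with rfl | rfl
  · exact le_rfl
  · exact Real.exp_le_exp.2 h

end Stack

/-! ### The price as a signed sum over demand and bid events -/

namespace Stack

variable (A : Stack)

/-- `exp L` on the event that `x ∈ (l, u]` and `R ≤ 0`. -/
def cell (L l u x R : ℝ) : ℝ := if l < x ∧ x ≤ u ∧ R ≤ 0 then Real.exp L else 0

/-- The market price as a function of the untruncated demand `x` and the log fuel prices `y`,
written as a sum over the events that determine which fuels set it. -/
def priceFormula (iplus : Fin 2) (y : Fin 2 → ℝ) (x : ℝ) : ℝ :=
  let h := A.logBid y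
  let δ : Fin 2 → ℝ := fun i => if i = iplus then -1 else 1
  (∑ i, (cell (h i x) 0 (A.cap i) x (1 * (h i x - h i.rev 0))
      + cell (h i (x - A.cap i.rev)) (A.cap i.rev) A.totalCap x
        (-1 * (h i (x - A.cap i.rev) - h i.rev (A.cap i.rev)))))
  + (∑ i, δ i * (-cell (A.logBidBoth y x) 0 (A.cap i) x (δ i * (h i x - h i.rev 0))
      + cell (A.logBidBoth y x) (A.cap i.rev) A.totalCap x
        (δ i * (h i (x - A.cap i.rev) - h i.rev (A.cap i.rev)))))
  + (∑ i, if x ≤ 0 ∧ h i 0 - h i.rev 0 ≤ 0 then Real.exp (h i 0) else 0)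
  + (∑ i, if A.totalCap < x ∧ -(h i (A.cap i) - h i.rev (A.cap i.rev)) ≤ 0 then
      Real.exp (h i (A.cap i)) else 0)

/-- No two bids that compete for the margin at demand `x` are equal. -/
structure NoTies (y : Fin 2 → ℝ) (x : ℝ) : Prop where
  low : ∀ i, A.logBid y i x ≠ A.logBid y i.rev 0
  high : ∀ i, A.logBid y i (x - A.cap i.rev) ≠ A.logBid y i.rev (A.cap i.rev)
  zero : A.logBid y 0 0 ≠ A.logBid y 1 0
  cap : A.logBid y 0 (A.cap 0) ≠ A.logBid y 1 (A.cap 1)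

variable {A} {y : Fin 2 → ℝ}

lemma totalCap_eq (i : Fin 2) : A.totalCap = A.cap i + A.cap i.rev := sum_fin_two_rev _ _

lemma totalCap_pos : 0 < A.totalCap := by
  rw [totalCap_eq 0]; exact add_pos (A.cap_pos _) (A.cap_pos _)

/-- The signs `δ` express the event that both fuels are marginal as a difference of nested events.
Let `i = iplus` and let `j` be the other fuel. Up to `cap j`, it is "`i` cannot set the price with
`j` idle" minus "`j` sets it with `i` idle". Between the capacities, the subtracted event is "`i`
sets it with `j` full". Above `cap i`, it is "`j` cannot set it with `i` full" minus that same
event. The cells use weak inequalities in both directions, so a tie could be counted twice; hence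
`NoTies`. -/
theorem price_eq_priceFormula {iplus : Fin 2} (hplus : ∀ i, A.cap i ≤ A.cap iplus) {x : ℝ}
    (hy : A.NoTies y x) :
    A.price (max 0 (min A.totalCap x)) (fun i => Real.exp (y i)) = A.priceFormula iplus y x := by
  have hmono : ∀ i, StrictMono (A.logBid y i) := fun i => logBid_strictMono i
  obtain ⟨hlow, hhigh, hzero, hcap⟩ := hy
  have hzero' : ∀ i : Fin 2, A.logBid y i 0 ≠ A.logBid y i.rev 0 := by
    intro i
    rcases eq_or_eq_rev 0 i with rfl | rfl
    · exact hzero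
    · exact hzero.symm
  have hcap' : ∀ i : Fin 2, A.logBid y i (A.cap i) ≠ A.logBid y i.rev (A.cap i.rev) := by
    intro i
    rcases eq_or_eq_rev 0 i with rfl | rfl
    · exact hcap
    · exact hcap.symm
  have htot := totalCap_eq (A := A) iplus
  have htot0 := totalCap_pos (A := A)
  have hci := A.cap_pos iplus
  have hcj := A.cap_pos iplus.rev
  have hcc := hplus iplus.rev
  have hli := hlow iplus
  have hlj := hlow iplus.rev
  have hhi := hhigh iplus
  have hhj := hhigh iplus.rev
  have hpli := price_eq_low (A := A) (y := y) (i := iplus) (x := x)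
  have hplj := price_eq_low (A := A) (y := y) (i := iplus.rev) (x := x)
  have hphi := price_eq_high (A := A) (y := y) (i := iplus) (x := x)
  have hphj := price_eq_high (A := A) (y := y) (i := iplus.rev) (x := x)
  have hp0i := price_eq_of_nonpos (A := A) (y := y) (i := iplus) (x := 0) le_rfl
  have hp0j := price_eq_of_nonpos (A := A) (y := y) (i := iplus.rev) (x := 0) le_rfl
  have hpti := price_eq_high (A := A) (y := y) (i := iplus) (x := A.totalCap)
  have hptj := price_eq_high (A := A) (y := y) (i := iplus.rev) (x := A.totalCap)
  -- `t₀` and `t₁` will be the extreme feasible supplies of the smaller fuel: `0` and `x`, then `0`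
  -- and its capacity, then `x - A.cap iplus` and its capacity, as demand grows.
  have hpb (t₀ t₁ : ℝ) := price_eq_both (A := A) (y := y) (i := iplus) (x := x) (t₀ := t₀)
    (t₁ := t₁)
  have h0 := hzero' iplus
  have h1 := hcap' iplus
  simp only [priceFormula, sum_fin_two_rev _ iplus, Fin.rev_rev, if_true, if_neg (ne_rev iplus),
    cell, neg_mul, one_mul, neg_sub, sub_nonpos, Set.mem_Ioc] at *
  clear hlow hhigh hzero hcap hzero' hcap' hplus
  generalize iplus.rev = j at *
  generalize iplus = i at *
  rcases le_or_gt x 0 with hx0 | hx0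
  · have e1 : ¬ 0 < x := hx0.not_gt
    have e2 : ¬ A.cap i < x := by linarith
    have e3 : ¬ A.cap j < x := by linarith
    have e4 : ¬ A.totalCap < x := by linarith
    rw [max_eq_left ((min_le_right _ _).trans hx0)]
    rcases h0.lt_or_gt with h | h
    · rw [hp0i h.le]
      simp [e1, e2, e3, e4, hx0, h.le, h.not_ge]
    · rw [hp0j h.le]
      simp [e1, e2, e3, e4, hx0, h.le, h.not_ge]
  have e0 : ¬ x ≤ 0 := hx0.not_ge
  rcases lt_or_ge A.totalCap x with hxt | hxt
  · have e1 : ¬ x ≤ A.cap i := by linarith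
    have e2 : ¬ x ≤ A.cap j := by linarith
    have e3 : A.totalCap - A.cap j = A.cap i := by linarith
    have e4 : A.totalCap - A.cap i = A.cap j := by linarith
    rw [e3] at hpti
    rw [e4] at hptj
    rw [min_eq_left hxt.le, max_eq_right htot0.le]
    rcases h1.lt_or_gt with h | h
    · rw [hptj (by linarith) (by linarith) h.le]
      simp [e0, e1, e2, hxt, hxt.not_ge, h.le, h.not_ge]
    · rw [hpti (by linarith) (by linarith) h.le]
      simp [e0, e1, e2, hxt, hxt.not_ge, h.le, h.not_ge]
  rw [min_eq_right hxt, max_eq_right hx0.le]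
  rcases le_or_gt x (A.cap j) with hxj | hxj
  · have hxi : x ≤ A.cap i := hxj.trans hcc
    rcases hli.lt_or_gt with h | h
    · have h' : A.logBid y i 0 < A.logBid y j x := by
        linarith [hmono i hx0, hmono j hx0]
      rw [hpli ⟨hx0, hxi⟩ h.le]
      simp [e0, hx0, hxi, hxj, hxi.not_gt, hxj.not_gt, hxt.not_gt, h.le, h.not_ge, h'.not_ge]
    rcases hlj.lt_or_gt with h' | h'
    · rw [hplj ⟨hx0, hxj⟩ h'.le]
      simp [e0, hx0, hxi, hxj, hxi.not_gt, hxj.not_gt, hxt.not_gt, h.le, h.not_ge, h'.le]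
    · have := hpb 0 x hx0 le_rfl hxj (by linarith) (by linarith)
        (by simpa using h.le) (by simpa using h'.le)
      rw [this]
      simp [e0, hx0, hxi, hxj, hxi.not_gt, hxj.not_gt, hxt.not_gt, h.le, h.not_ge, h'.not_ge]
  rcases le_or_gt x (A.cap i) with hxi | hxi
  · rcases hli.lt_or_gt with h | h
    · have h' : A.logBid y i (x - A.cap j) < A.logBid y j (A.cap j) := by
        linarith [hmono i (sub_lt_self x hcj), hmono j hcj]
      rw [hpli ⟨hx0, hxi⟩ h.le]
      simp [e0, hx0, hxi, hxj, hxj.not_ge, hxi.not_gt, hxt, hxt.not_gt, h.le, h.not_ge, h'.not_ge]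
    rcases hhi.lt_or_gt with h' | h'
    · have := hpb 0 (A.cap j) hx0 le_rfl le_rfl (by linarith) (by linarith)
        (by simpa using h.le) h'.le
      rw [this]
      simp [e0, hx0, hxi, hxj, hxj.not_ge, hxi.not_gt, hxt, hxt.not_gt, h.le, h.not_ge, h'.not_ge]
    · rw [hphi hxj (by linarith) h'.le]
      simp [e0, hx0, hxi, hxj, hxj.not_ge, hxi.not_gt, hxt, hxt.not_gt, h.le, h.not_ge, h'.le]
  · rcases hhi.lt_or_gt with h | h
    · rcases hhj.lt_or_gt with h' | h'
      · have := hpb (x - A.cap i) (A.cap j) hx0 (by linarith) le_rfl (by linarith) (by linarith)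
          (by simpa using h'.le) h.le
        rw [this]
        simp [e0, hx0, hxi, hxj, hxj.not_ge, hxi.not_ge, hxt, hxt.not_gt, h.not_ge, h'.le,
          h'.not_ge]
      · rw [hphj hxi (by linarith) h'.le]
        simp [e0, hx0, hxi, hxj, hxj.not_ge, hxi.not_ge, hxt, hxt.not_gt, h.not_ge, h'.le,
          h'.not_ge]
    · have h' : A.logBid y j (x - A.cap i) < A.logBid y i (A.cap i) := by
        linarith [(hmono i).monotone (show x - A.cap j ≤ A.cap i by linarith),
          (hmono j).monotone (show x - A.cap i ≤ A.cap j by linarith)]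
      rw [hphi hxj (by linarith) h.le]
      simp [e0, hx0, hxi, hxj, hxj.not_ge, hxi.not_ge, hxt, hxt.not_gt, h.le, h'.le, h'.not_ge]

end Stack

/-! ### Conditional laws and conditional expectations -/

namespace HasCondLaw

variable {Ω E : Type*} {m mΩ : MeasurableSpace Ω} [MeasurableSpace E] {Q : Measure Ω}
  {Y : Ω → E} {ν : Ω → Measure E}

/-- The probability of the event is the mean of its conditional probability, which vanishes. This is
used to discard ties. -/
lemma ae_notMem [IsFiniteMeasure Q] (h : HasCondLaw Q m Y ν) (hm : m ≤ mΩ) (hY : Measurable Y)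
    {N : Set E} (hN : MeasurableSet N) (hν : ∀ ω, ν ω N = 0) : ∀ᵐ ω ∂Q, Y ω ∉ N := by
  have h0 : ∫ ω, (Y ⁻¹' N).indicator (fun _ => (1 : ℝ)) ω ∂Q = 0 := by
    rw [← integral_condExp hm, integral_congr_ae (h N hN)]
    simp [measureReal_def, hν]
  rw [integral_indicator_const (1 : ℝ) (hY hN), smul_eq_mul, mul_one, measureReal_eq_zero_iff] at h0
  exact measure_eq_zero_iff_ae_notMem.1 h0

variable [StandardBorelSpace E] [Nonempty E]

/-- The exceptional null set in `HasCondLaw` depends on the event. A countable generating algebra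
allows a single null set, and being a π-system it determines the measure. No measurability of `ν` in
`ω` is needed. -/
lemma ae_condDistrib_eq [IsFiniteMeasure Q] [∀ ω, IsProbabilityMeasure (ν ω)]
    (h : HasCondLaw Q m Y ν) (hm : m ≤ mΩ) (hY : Measurable Y) :
    ∀ᵐ ω ∂Q, @condDistrib Ω Ω E _ _ _ mΩ m Y id Q _ ω = ν ω := by
  set C := generateSetAlgebra (MeasurableSpace.countableGeneratingSet E) with hC
  have hCalg : IsSetAlgebra C := isSetAlgebra_generateSetAlgebra
  have hgen : MeasurableSpace.generateFrom C = ‹MeasurableSpace E› := by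
    rw [hC, generateFrom_generateSetAlgebra_eq,
      MeasurableSpace.generateFrom_countableGeneratingSet]
  have hmeas : ∀ B ∈ C, MeasurableSet B := fun B hB => by
    rw [← hgen]; exact MeasurableSpace.measurableSet_generateFrom hB
  have hcount : C.Countable :=
    countable_generateSetAlgebra MeasurableSpace.countable_countableGeneratingSet
  have hid : @Measurable Ω Ω mΩ m id := measurable_id'' hm
  have key : ∀ᵐ ω ∂Q, ∀ B ∈ C,
      (@condDistrib Ω Ω E _ _ _ mΩ m Y id Q _ ω).real B = (ν ω).real B := by
    refine (ae_ball_iff hcount).2 fun B hB => ?_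
    have h1 := condDistrib_ae_eq_condExp (μ := Q) hid hY (hmeas B hB)
    rw [MeasurableSpace.comap_id] at h1
    exact h1.trans (h B (hmeas B hB))
  filter_upwards [key] with ω hω
  refine ext_of_generate_finite C hgen.symm (fun s hs t ht _ => hCalg.inter_mem hs ht)
    (fun B hB => ?_) (by simp)
  simpa [measureReal_def, ENNReal.toReal_eq_toReal_iff'] using hω B hB

theorem condExp_comp_ae_eq [IsFiniteMeasure Q] [∀ ω, IsProbabilityMeasure (ν ω)]
    (h : HasCondLaw Q m Y ν) (hm : m ≤ mΩ) (hY : Measurable Y) {f : E → ℝ} (hf : Measurable f)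
    (hint : Integrable (fun ω => f (Y ω)) Q) :
    Q[fun ω => f (Y ω) | m] =ᵐ[Q] fun ω => ∫ y, f y ∂(ν ω) := by
  have hid : @Measurable Ω Ω mΩ m id := measurable_id'' hm
  have h1 := condExp_ae_eq_integral_condDistrib (μ := Q) hid hY.aemeasurable
    hf.stronglyMeasurable hint
  rw [MeasurableSpace.comap_id] at h1
  filter_upwards [h1, h.ae_condDistrib_eq hm hY] with ω h1 h2
  rw [h1, id, h2]

end HasCondLaw

/-! ### Exponential moments of Gaussian vectors on half planes -/

/-- The standard normal law. -/
abbrev stdNormal : Measure ℝ := gaussianReal 0 1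

/-- Completing the square: `p z - z²/2 = p²/2 - (z - p)²/2`, followed by translation invariance of
Lebesgue measure. -/
lemma lintegral_exp_mul_stdNormal (p : ℝ) {f : ℝ → ENNReal} (hf : Measurable f) :
    ∫⁻ z, ENNReal.ofReal (Real.exp (p * z)) * f z ∂stdNormal =
      ENNReal.ofReal (Real.exp (p ^ 2 / 2)) * ∫⁻ z, f (z + p) ∂stdNormal := by
  have hm : Measurable fun z : ℝ => ENNReal.ofReal (Real.exp (p * z)) * f z := by fun_prop
  rw [stdNormal, gaussianReal_of_var_ne_zero 0 one_ne_zero,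
    lintegral_withDensity_eq_lintegral_mul _ (measurable_gaussianPDF 0 1) hm,
    lintegral_withDensity_eq_lintegral_mul _ (measurable_gaussianPDF 0 1)
      (show Measurable fun z => f (z + p) by fun_prop),
    ← lintegral_sub_right_eq_self (fun z => (gaussianPDF 0 1 * fun z => f (z + p)) z) p,
    ← lintegral_const_mul _ (by
      simp only [Pi.mul_apply]
      exact ((measurable_gaussianPDF 0 1).comp (measurable_sub_const p)).mul (by fun_prop))]
  refine lintegral_congr fun z => ?_
  simp only [Pi.mul_apply, sub_add_cancel, gaussianPDF, gaussianPDFReal]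
  rw [← mul_assoc, ← mul_assoc, ← ENNReal.ofReal_mul (by positivity),
    ← ENNReal.ofReal_mul (by positivity)]
  congr 2
  rw [mul_assoc, mul_left_comm (Real.exp _), ← Real.exp_add, ← Real.exp_add]
  congr 2
  simp only [NNReal.coe_one]
  ring

lemma lintegral_exp_add_mul_stdNormal_prod (p q : ℝ) {f : ℝ × ℝ → ENNReal} (hf : Measurable f) :
    ∫⁻ z, ENNReal.ofReal (Real.exp (p * z.1 + q * z.2)) * f z ∂(stdNormal.prod stdNormal) =
      ENNReal.ofReal (Real.exp ((p ^ 2 + q ^ 2) / 2)) *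
        ∫⁻ z, f (z.1 + p, z.2 + q) ∂(stdNormal.prod stdNormal) := by
  rw [lintegral_prod _ (by fun_prop), lintegral_prod _ (by fun_prop)]
  have h1 (x : ℝ) : ∫⁻ y, ENNReal.ofReal (Real.exp (p * x + q * y)) * f (x, y) ∂stdNormal =
      ENNReal.ofReal (Real.exp (p * x)) * (ENNReal.ofReal (Real.exp (q ^ 2 / 2)) *
        ∫⁻ y, f (x, y + q) ∂stdNormal) := by
    rw [← lintegral_exp_mul_stdNormal q (f := fun y => f (x, y)) (by fun_prop),
      ← lintegral_const_mul _ (by fun_prop)]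
    refine lintegral_congr fun y => ?_
    rw [← mul_assoc, ← ENNReal.ofReal_mul (by positivity), ← Real.exp_add]
  have hm : Measurable fun x => ∫⁻ y, f (x, y + q) ∂stdNormal :=
    Measurable.lintegral_prod_right' (f := fun z : ℝ × ℝ => f (z.1, z.2 + q)) (by fun_prop)
  simp_rw [h1]
  rw [lintegral_exp_mul_stdNormal p (hm.const_mul _), lintegral_const_mul _ (by fun_prop),
    ← mul_assoc, ← ENNReal.ofReal_mul (by positivity), ← Real.exp_add, add_div]

/-- The event ignores the middle factor, so the shift by `b` in that direction leaves only the
constant `b²/2`; the shifts by `p` and `q` move the event. Working with `lintegral` first yields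
integrability from the finite value. -/
lemma integral_exp_indicator_stdNormal (L p b q : ℝ) {B : Set (ℝ × ℝ)} (hB : MeasurableSet B) :
    Integrable (fun z : (ℝ × ℝ) × ℝ =>
        B.indicator (fun _ => Real.exp (L + p * z.1.1 + b * z.1.2 + q * z.2)) (z.1.1, z.2))
      ((stdNormal.prod stdNormal).prod stdNormal) ∧
    ∫ z : (ℝ × ℝ) × ℝ,
        B.indicator (fun _ => Real.exp (L + p * z.1.1 + b * z.1.2 + q * z.2)) (z.1.1, z.2)
      ∂((stdNormal.prod stdNormal).prod stdNormal) =
    Real.exp (L + (p ^ 2 + b ^ 2 + q ^ 2) / 2) *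
      (stdNormal.prod stdNormal).real {w | (w.1 + p, w.2 + q) ∈ B} := by
  set f : (ℝ × ℝ) × ℝ → ℝ := fun z =>
    B.indicator (fun _ => Real.exp (L + p * z.1.1 + b * z.1.2 + q * z.2)) (z.1.1, z.2) with hf
  have hfm : Measurable f := by
    have : f = ((fun z : (ℝ × ℝ) × ℝ => (z.1.1, z.2)) ⁻¹' B).indicator
        (fun z => Real.exp (L + p * z.1.1 + b * z.1.2 + q * z.2)) := rfl
    rw [this]
    exact Measurable.indicator (by fun_prop) (hB.preimage (by fun_prop))
  have hf0 : ∀ z, 0 ≤ f z := fun z => Set.indicator_nonneg (fun _ _ => (Real.exp_pos _).le) _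
  have hBp : MeasurableSet {w : ℝ × ℝ | (w.1 + p, w.2 + q) ∈ B} := hB.preimage (by fun_prop)
  have hBm : Measurable (B.indicator (fun _ => (1 : ENNReal))) := measurable_const.indicator hB
  have hL : ∫⁻ z, ENNReal.ofReal (f z) ∂((stdNormal.prod stdNormal).prod stdNormal) =
      ENNReal.ofReal (Real.exp (L + (p ^ 2 + b ^ 2 + q ^ 2) / 2)) *
        (stdNormal.prod stdNormal) {w | (w.1 + p, w.2 + q) ∈ B} := by
    have e1 : ∀ z, ENNReal.ofReal (f z) = ENNReal.ofReal (Real.exp L) *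
        (ENNReal.ofReal (Real.exp (p * z.1.1 + b * z.1.2)) *
          (ENNReal.ofReal (Real.exp (q * z.2)) * B.indicator (fun _ => 1) (z.1.1, z.2))) := by
      intro z
      rw [← mul_assoc, ← mul_assoc, ← ENNReal.ofReal_mul (by positivity), ← Real.exp_add,
        ← ENNReal.ofReal_mul (by positivity), ← Real.exp_add]
      by_cases hz : (z.1.1, z.2) ∈ B <;> simp [hf, hz, add_assoc]
    simp_rw [e1]
    rw [lintegral_const_mul _ (by fun_prop), lintegral_prod _ (by fun_prop)]
    have hm : Measurable fun w : ℝ =>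
        ∫⁻ y, B.indicator (fun _ => (1 : ENNReal)) (w, y + q) ∂stdNormal :=
      Measurable.lintegral_prod_right' (f := fun z : ℝ × ℝ =>
        B.indicator (fun _ => (1 : ENNReal)) (z.1, z.2 + q)) (by fun_prop)
    have e2 (w : ℝ × ℝ) : ∫⁻ y, ENNReal.ofReal (Real.exp (p * w.1 + b * w.2)) *
        (ENNReal.ofReal (Real.exp (q * y)) * B.indicator (fun _ => 1) (w.1, y)) ∂stdNormal =
        ENNReal.ofReal (Real.exp (p * w.1 + b * w.2)) * (ENNReal.ofReal (Real.exp (q ^ 2 / 2)) *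
          ∫⁻ y, B.indicator (fun _ => 1) (w.1, y + q) ∂stdNormal) := by
      rw [lintegral_const_mul _ (by fun_prop),
        lintegral_exp_mul_stdNormal q (f := fun y => B.indicator (fun _ => 1) (w.1, y))
          (by fun_prop)]
    have e3 : ∫⁻ z : ℝ × ℝ, ENNReal.ofReal (Real.exp (q ^ 2 / 2)) *
        ∫⁻ y, B.indicator (fun _ => 1) (z.1 + p, y + q) ∂stdNormal ∂(stdNormal.prod stdNormal) =
        ENNReal.ofReal (Real.exp (q ^ 2 / 2)) *
          ∫⁻ x, ∫⁻ y, B.indicator (fun _ => 1) (x + p, y + q) ∂stdNormal ∂stdNormal := by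
      have hm' : Measurable fun z : ℝ × ℝ =>
          ∫⁻ y, B.indicator (fun _ => (1 : ENNReal)) (z.1 + p, y + q) ∂stdNormal :=
        (hm.comp (measurable_add_const p)).comp measurable_fst
      rw [lintegral_const_mul _ hm', lintegral_prod _ hm'.aemeasurable]
      simp
    simp_rw [e2]
    rw [lintegral_exp_add_mul_stdNormal_prod p b (f := fun w => ENNReal.ofReal
        (Real.exp (q ^ 2 / 2)) * ∫⁻ y, B.indicator (fun _ => 1) (w.1, y + q) ∂stdNormal)
        ((hm.comp measurable_fst).const_mul _), e3]
    rw [← mul_assoc, ← mul_assoc, ← ENNReal.ofReal_mul (by positivity), ← Real.exp_add,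
      ← ENNReal.ofReal_mul (by positivity), ← Real.exp_add, Measure.prod_apply hBp]
    congr 1
    · congr 2; ring
    · refine lintegral_congr fun x => ?_
      rw [← lintegral_indicator_one (hBp.preimage measurable_prodMk_left)]
      rfl
  have hfin : HasFiniteIntegral f ((stdNormal.prod stdNormal).prod stdNormal) := by
    rw [hasFiniteIntegral_iff_ofReal (Filter.Eventually.of_forall hf0), hL]
    exact ENNReal.mul_lt_top ENNReal.ofReal_lt_top (measure_lt_top _ _)
  refine ⟨⟨hfm.aestronglyMeasurable, hfin⟩, ?_⟩
  rw [integral_eq_lintegral_of_nonneg_ae (Filter.Eventually.of_forall hf0)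
    hfm.aestronglyMeasurable, hL, ENNReal.toReal_mul, ENNReal.toReal_ofReal (by positivity),
    measureReal_def]

lemma map_stdNormal_prod (m a b : Fin 2 → ℝ) :
    (stdNormal.prod stdNormal).map
        (fun z => WithLp.toLp 2 (fun i => m i + a i * z.1 + b i * z.2)) =
      multivariateGaussian (WithLp.toLp 2 m)
        (Matrix.vecMulVec a a + Matrix.vecMulVec b b) := by
  have hps : (Matrix.vecMulVec a a + Matrix.vecMulVec b b).PosSemidef := by
    have h (c : Fin 2 → ℝ) : (Matrix.vecMulVec c c).PosSemidef := by
      simpa using Matrix.posSemidef_vecMulVec_self_star c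
    exact (h a).add (h b)
  have hmeas : Measurable fun z : ℝ × ℝ => (WithLp.toLp 2
      (fun i => m i + a i * z.1 + b i * z.2) : EuclideanSpace ℝ (Fin 2)) := by fun_prop
  have := Measure.isProbabilityMeasure_map (μ := stdNormal.prod stdNormal) hmeas.aemeasurable
  refine Measure.ext_of_charFun (funext fun t => ?_)
  rw [charFun_multivariateGaussian hps, charFun_apply, integral_map hmeas.aemeasurable
    (by fun_prop)]
  have e1 (z : ℝ × ℝ) : Complex.exp (inner ℝ (WithLp.toLp 2
      (fun i => m i + a i * z.1 + b i * z.2) : EuclideanSpace ℝ (Fin 2)) t * Complex.I) =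
      Complex.exp ((t 0 * m 0 + t 1 * m 1 : ℝ) * Complex.I) *
      (Complex.exp ((t 0 * a 0 + t 1 * a 1 : ℝ) * z.1 * Complex.I) *
        Complex.exp ((t 0 * b 0 + t 1 * b 1 : ℝ) * z.2 * Complex.I)) := by
    rw [← Complex.exp_add, ← Complex.exp_add]
    congr 1
    simp only [PiLp.inner_apply, Fin.sum_univ_two, RCLike.inner_apply, conj_trivial]
    push_cast
    ring
  simp_rw [e1]
  rw [integral_const_mul, integral_prod_mul
    (fun z : ℝ => Complex.exp ((t 0 * a 0 + t 1 * a 1 : ℝ) * z * Complex.I))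
    (fun z : ℝ => Complex.exp ((t 0 * b 0 + t 1 * b 1 : ℝ) * z * Complex.I)),
    ← charFun_apply_real, ← charFun_apply_real, charFun_gaussianReal, charFun_gaussianReal,
    ← Complex.exp_add, ← Complex.exp_add]
  congr 1
  simp only [PiLp.inner_apply, Fin.sum_univ_two, RCLike.inner_apply, conj_trivial,
    dotProduct, Matrix.mulVec, Matrix.add_apply, Matrix.vecMulVec_apply, NNReal.coe_one]
  push_cast
  ring

lemma Phi2_eq {c d : ℝ} (h : c ^ 2 + d ^ 2 = 1) (x y : ℝ) :
    Phi2 x y d = (stdNormal.prod stdNormal).real {w | w.2 ≤ x ∧ c * w.1 + d * w.2 ≤ y} := by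
  -- The pair `(w.2, c * w.1 + d * w.2)` has unit variances, because `c² + d² = 1`, and correlation
  -- `d`.
  have h1 := map_stdNormal_prod 0 ![0, c] ![1, d]
  have h2 : Matrix.vecMulVec ![0, c] ![0, c] + Matrix.vecMulVec ![1, d] ![1, d] =
      !![1, d; d, 1] := by
    ext i j
    fin_cases i <;> fin_cases j <;> simp
    linarith
  rw [h2] at h1
  have h3 : MeasurableSet {z : EuclideanSpace ℝ (Fin 2) | z 0 ≤ x ∧ z 1 ≤ y} := by
    measurability
  rw [Phi2, show (0 : EuclideanSpace ℝ (Fin 2)) = WithLp.toLp 2 0 from rfl, ← h1,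
    map_measureReal_apply (by fun_prop) h3]
  simp

lemma Phi1_eq (x : ℝ) : Phi1 x = stdNormal.real (Set.Iic x) := cdf_eq_real _ _

lemma stdNormal_real_halfLine {c : ℝ} (hc : c ≠ 0) (z : ℝ) :
    stdNormal.real {w | c * w ≤ z} = Phi1 (z / |c|) := by
  rw [Phi1_eq]
  rcases hc.lt_or_gt with h | h
  · have h1 := gaussianReal_map_neg (μ := 0) (v := 1)
    rw [neg_zero] at h1
    rw [stdNormal, ← h1, map_measureReal_apply (by fun_prop) (measurableSet_le (by fun_prop)
      (by fun_prop)), h1]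
    congr 1
    ext w
    simp only [Set.mem_preimage, Set.mem_ofPred_eq, Set.mem_Iic, abs_of_neg h]
    rw [le_div_iff₀ (by linarith)]
    constructor <;> intro h <;> linarith
  · congr 1
    ext w
    simp only [Set.mem_ofPred_eq, Set.mem_Iic, abs_of_pos h]
    rw [le_div_iff₀ h, mul_comm]

lemma stdNormal_prod_real_strip {l u c d r : ℝ} (hlu : l ≤ u) (hr : 0 < r)
    (hcd : r ^ 2 = c ^ 2 + d ^ 2) (z : ℝ) :
    (stdNormal.prod stdNormal).real {w | l < w.2 ∧ w.2 ≤ u ∧ c * w.1 + d * w.2 ≤ z} =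
      Phi2Diff u l (z / r) (d / r) := by
  have h1 : (c / r) ^ 2 + (d / r) ^ 2 = 1 := by
    rw [div_pow, div_pow, ← add_div, ← hcd, div_self (by positivity)]
  have h2 (w : ℝ × ℝ) : c / r * w.1 + d / r * w.2 ≤ z / r ↔ c * w.1 + d * w.2 ≤ z := by
    rw [div_mul_eq_mul_div, div_mul_eq_mul_div, ← add_div, div_le_div_iff_of_pos_right hr]
  rw [Phi2Diff, Phi2_eq h1, Phi2_eq h1]
  simp only [h2]
  have hm : MeasurableSet {w : ℝ × ℝ | w.2 ≤ l ∧ c * w.1 + d * w.2 ≤ z} := by measurability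
  have hsub : {w : ℝ × ℝ | w.2 ≤ l ∧ c * w.1 + d * w.2 ≤ z} ⊆
      {w | w.2 ≤ u ∧ c * w.1 + d * w.2 ≤ z} := fun w hw => ⟨hw.1.trans hlu, hw.2⟩
  rw [← measureReal_sdiff hsub hm]
  congr 1
  ext w
  simp only [Set.mem_ofPred_eq, Set.mem_sdiff]
  constructor
  · rintro ⟨h1, h2, h3⟩
    exact ⟨⟨h2, h3⟩, fun h => h1.not_ge h.1⟩
  · rintro ⟨⟨h2, h3⟩, h⟩
    exact ⟨not_le.1 fun h' => h ⟨h', h3⟩, h2, h3⟩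

/-! ### The price under independent standard normal factors -/

/-- The function `f` is integrable with integral `v`. -/
def IntegralEq {Z : Type*} [MeasurableSpace Z] (M : Measure Z) (f : Z → ℝ) (v : ℝ) : Prop :=
  Integrable f M ∧ ∫ z, f z ∂M = v

namespace IntegralEq

variable {Z : Type*} [MeasurableSpace Z] {M : Measure Z} {f g : Z → ℝ} {v w : ℝ}

lemma add (hf : IntegralEq M f v) (hg : IntegralEq M g w) :
    IntegralEq M (fun z => f z + g z) (v + w) :=
  ⟨hf.1.add hg.1, by rw [integral_add hf.1 hg.1, hf.2, hg.2]⟩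

lemma neg (hf : IntegralEq M f v) : IntegralEq M (fun z => -f z) (-v) :=
  ⟨hf.1.neg, by rw [integral_neg, hf.2]⟩

lemma const_mul (c : ℝ) (hf : IntegralEq M f v) : IntegralEq M (fun z => c * f z) (c * v) :=
  ⟨hf.1.const_mul c, by rw [integral_const_mul, hf.2]⟩

lemma sum {ι : Type*} [Fintype ι] {f : ι → Z → ℝ} {v : ι → ℝ}
    (hf : ∀ i, IntegralEq M (f i) (v i)) : IntegralEq M (fun z => ∑ i, f i z) (∑ i, v i) :=
  ⟨integrable_finsetSum _ fun i _ => (hf i).1, by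
    rw [integral_finsetSum _ fun i _ => (hf i).1]
    exact Finset.sum_congr rfl fun i _ => (hf i).2⟩

end IntegralEq

/-- The law of three independent standard normal variables. -/
abbrev stdNormal₃ : Measure ((ℝ × ℝ) × ℝ) := (stdNormal.prod stdNormal).prod stdNormal

lemma integralEq_exp_of_eq_indicator {L P p b q : ℝ} {f : (ℝ × ℝ) × ℝ → ℝ} {B : Set (ℝ × ℝ)}
    (hB : MeasurableSet B) (hL : P + (p ^ 2 + b ^ 2 + q ^ 2) / 2 = L)
    (hf : ∀ z, f z =
      B.indicator (fun _ => Real.exp (P + p * z.1.1 + b * z.1.2 + q * z.2)) (z.1.1, z.2)) :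
    IntegralEq stdNormal₃ f
      (Real.exp L * (stdNormal.prod stdNormal).real {w | (w.1 + p, w.2 + q) ∈ B}) := by
  rw [show f = _ from funext hf, ← hL]
  exact integral_exp_indicator_stdNormal P p b q hB

/-- The common computation behind all `Φ₂` terms. The parameters of the value are tied to the
coefficients by equations, so that each application reduces to algebra. -/
lemma integralEq_cell {l u P p b q c d r sd μd σd E v ρ x₁ x₂ : ℝ} {L x R : (ℝ × ℝ) × ℝ → ℝ}
    (hL : ∀ z, L z = P + p * z.1.1 + b * z.1.2 + q * z.2) (hx : ∀ z, x z = μd + σd * z.2)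
    (hR : ∀ z, R z = c * z.1.1 + d * z.2 - r) (hlu : l ≤ u) (hσd : 0 < σd) (hsd : 0 < sd)
    (hcd : sd ^ 2 = c ^ 2 + d ^ 2) (hE : P + (p ^ 2 + b ^ 2 + q ^ 2) / 2 = E)
    (hx₁ : (u - μd) / σd - q = x₁) (hx₂ : (l - μd) / σd - q = x₂)
    (hv : (r - c * p - d * q) / sd = v) (hρ : d / sd = ρ) :
    IntegralEq stdNormal₃ (fun z => Stack.cell (L z) l u (x z) (R z))
      (Real.exp E * Phi2Diff x₁ x₂ v ρ) := by
  set B : Set (ℝ × ℝ) := {w | l < μd + σd * w.2 ∧ μd + σd * w.2 ≤ u ∧ c * w.1 + d * w.2 - r ≤ 0}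
    with hBdef
  have hB : MeasurableSet B := by rw [hBdef]; measurability
  have h1 := integralEq_exp_of_eq_indicator
    (f := fun z => Stack.cell (L z) l u (x z) (R z)) (P := P)
    (p := p) (b := b) (q := q) hB hE (fun z => by
      simp only [Stack.cell, hL, hx, hR, Set.indicator_apply, hBdef, Set.mem_ofPred_eq])
  have h2 : {w : ℝ × ℝ | (w.1 + p, w.2 + q) ∈ B} = {w | (l - μd) / σd - q < w.2 ∧
      w.2 ≤ (u - μd) / σd - q ∧ c * w.1 + d * w.2 ≤ r - c * p - d * q} := by
    ext w
    simp only [hBdef, Set.mem_ofPred_eq, sub_lt_iff_lt_add, le_sub_iff_add_le, div_lt_iff₀ hσd,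
      le_div_iff₀ hσd]
    refine and_congr ?_ (and_congr ?_ ?_) <;> constructor <;> intro h <;> linarith
  rw [h2, stdNormal_prod_real_strip (by gcongr) hsd hcd, hx₁, hx₂, hv, hρ] at h1
  exact h1

lemma stdNormal_real_Ioi (u : ℝ) : stdNormal.real (Set.Ioi u) = Phi1 (-u) := by
  have h1 := gaussianReal_map_neg (μ := 0) (v := 1)
  rw [neg_zero] at h1
  have := nullSingletonClass_gaussianReal (μ := 0) (v := 1) one_ne_zero
  rw [Phi1_eq, stdNormal, ← measureReal_congr (Iio_ae_eq_Iic (μ := gaussianReal 0 1) (a := -u)),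
    ← h1, map_measureReal_apply (by fun_prop) measurableSet_Ioi, h1]
  congr 1
  ext w
  simp

/-- Where demand is clipped, the exponent and the bid comparison no longer contain it. The event is
then a product set, and its measure splits into two `Phi1` factors. -/
lemma integralEq_edge {P p b c r σ μd σd E v x : ℝ} {D : Set ℝ} {X : (ℝ × ℝ) × ℝ → Prop}
    [DecidablePred X] {L R : (ℝ × ℝ) × ℝ → ℝ} (hD : MeasurableSet D)
    (hL : ∀ z, L z = P + p * z.1.1 + b * z.1.2) (hX : ∀ z, X z ↔ μd + σd * z.2 ∈ D)
    (hDx : stdNormal.real {w | μd + σd * w ∈ D} = Phi1 x)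
    (hR : ∀ z, R z = c * z.1.1 - r) (hσ : 0 < σ) (hc : c ^ 2 = σ ^ 2)
    (hE : P + (p ^ 2 + b ^ 2) / 2 = E) (hv : (r - c * p) / σ = v) :
    IntegralEq stdNormal₃ (fun z => if X z ∧ R z ≤ 0 then Real.exp (L z) else 0)
      (Phi1 x * (Real.exp E * Phi1 v)) := by
  have hc0 : c ≠ 0 := by
    rintro rfl
    nlinarith
  have hca : |c| = σ := by rw [← abs_of_pos hσ]; exact (sq_eq_sq_iff_abs_eq_abs _ _).1 hc
  set B : Set (ℝ × ℝ) := {w | c * w.1 - r ≤ 0} ∩ {w | μd + σd * w.2 ∈ D} with hBdef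
  have hB : MeasurableSet B :=
    (measurableSet_le (by fun_prop) (by fun_prop)).inter (hD.preimage (by fun_prop))
  have h1 := integralEq_exp_of_eq_indicator
    (f := fun z => if X z ∧ R z ≤ 0 then Real.exp (L z) else 0)
    (P := P) (p := p) (b := b) (q := 0) (L := E) hB (by rw [← hE]; ring) (fun z => by
      classical
      rw [Set.indicator_apply]
      refine if_congr ?_ (by rw [hL, zero_mul, add_zero]) rfl
      rw [hX, hR, and_comm]
      rfl)
  have h2 : {w : ℝ × ℝ | (w.1 + p, w.2 + 0) ∈ B} =
      {w | c * w ≤ r - c * p} ×ˢ {w | μd + σd * w ∈ D} := by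
    ext w
    simp only [hBdef, Set.mem_ofPred_eq, Set.mem_inter_iff, Set.mem_prod, add_zero]
    refine and_congr_left fun _ => ?_
    constructor <;> intro h <;> linarith
  rw [h2, measureReal_prod_prod, stdNormal_real_halfLine hc0, hca, hDx, hv] at h1
  rw [mul_left_comm, mul_comm (Phi1 x)]
  exact h1

namespace Stack

variable (A : Stack) (μ a : Fin 2 → ℝ) (b μd σd : ℝ)

/-- The log fuel prices as affine functions of standard normal factors. -/
def logFuel (z : (ℝ × ℝ) × ℝ) (i : Fin 2) : ℝ := μ i + a i * z.1.1 + b * z.1.2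

/-- The untruncated demand as an affine function of standard normal factors. -/
def demand (z : (ℝ × ℝ) × ℝ) : ℝ := μd + σd * z.2

/-- The mean of the fuel price when its logarithm is given by `logFuel`. -/
def meanFuel (i : Fin 2) : ℝ := Real.exp (μ i + (a i ^ 2 + b ^ 2) / 2)

variable {A μ a b μd σd} {σ : ℝ}

lemma sigmaD_pos (hσ : 0 < σ) (i : Fin 2) : 0 < A.sigmaD σ σd i :=
  Real.sqrt_pos.2 (by positivity)

lemma sq_sigmaD (i : Fin 2) : A.sigmaD σ σd i ^ 2 = A.m i ^ 2 * σd ^ 2 + σ ^ 2 :=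
  Real.sq_sqrt (by positivity)

lemma sq_sub_rev (hσa : σ = a 1 - a 0) (i : Fin 2) : (a i - a i.rev) ^ 2 = σ ^ 2 := by
  rcases eq_or_eq_rev 0 i with rfl | rfl
  · rw [hσa, show (0 : Fin 2).rev = 1 from rfl]; ring
  · rw [hσa, show (0 : Fin 2).rev = 1 from rfl, show (1 : Fin 2).rev = 0 from rfl]

/-- The lognormal corrections in the forward prices combine with `-σ²/2` into `-(a i - a i.rev) * a
i`, the displacement of the bid gap caused by weighting with the price of fuel `i`. -/
lemma R_meanFuel (hσa : σ = a 1 - a 0) (i : Fin 2) (x y : ℝ) :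
    A.R σ (meanFuel μ a b) i x y = A.k i.rev + A.m i.rev * y + μ i.rev - A.k i - A.m i * x - μ i
      - (a i - a i.rev) * a i := by
  simp only [R, meanFuel, Real.log_exp, ← sq_sub_rev hσa i]
  ring

/-- Both orientations of the comparison are covered by `ε`. The offsets `x₀`, `y₀` are `0` when the
other fuel is idle and its capacity when it runs in full. -/
lemma integralEq_cell_alone (hσ : 0 < σ) (hσd : 0 < σd) (hσa : σ = a 1 - a 0) (i : Fin 2)
    {ε : ℝ} (hε : ε ^ 2 = 1) (x₀ y₀ : ℝ) {l u : ℝ} (hlu : l ≤ u) :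
    IntegralEq stdNormal₃ (fun z =>
        cell (A.logBid (logFuel μ a b z) i (demand μd σd z - x₀)) l u (demand μd σd z)
          (ε * (A.logBid (logFuel μ a b z) i (demand μd σd z - x₀) -
            A.logBid (logFuel μ a b z) i.rev y₀)))
      (Real.exp (A.m i ^ 2 * σd ^ 2 / 2) * (A.bid i (μd - x₀) (meanFuel μ a b i) *
        Phi2Diff ((u - μd) / σd - A.m i * σd) ((l - μd) / σd - A.m i * σd)
          (ε * (A.R σ (meanFuel μ a b) i (μd - x₀) y₀ - A.m i ^ 2 * σd ^ 2) / A.sigmaD σ σd i)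
          (ε * (A.m i * σd) / A.sigmaD σ σd i))) := by
  rw [← mul_assoc, bid, meanFuel, ← Real.exp_add, ← Real.exp_add]
  refine integralEq_cell (p := a i) (q := A.m i * σd) (P := μ i + A.k i + A.m i * (μd - x₀))
    (b := b) (c := ε * (a i - a i.rev))
    (r := -ε * (μ i + A.k i + A.m i * (μd - x₀) - (μ i.rev + A.k i.rev + A.m i.rev * y₀)))
    (fun z => ?_) (fun z => rfl) (fun z => ?_) hlu hσd (sigmaD_pos hσ i) ?_ ?_ rfl rfl ?_ rfl
  · simp only [logBid, logFuel, demand]; ring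
  · simp only [logBid, logFuel, demand]; ring
  · rw [sq_sigmaD, mul_pow, mul_pow, mul_pow, hε, sq_sub_rev hσa]; ring
  · ring
  · rw [R_meanFuel hσa]
    ring_nf

lemma integralEq_cell_both (hσ : 0 < σ) (hσd : 0 < σd) (hσa : σ = a 1 - a 0) (i : Fin 2)
    {ε : ℝ} (hε : ε = 1 ∨ ε = -1) (x₀ y₀ : ℝ) {l u : ℝ} (hlu : l ≤ u) :
    IntegralEq stdNormal₃ (fun z =>
        cell (A.logBidBoth (logFuel μ a b z) (demand μd σd z)) l u (demand μd σd z)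
          (ε * (A.logBid (logFuel μ a b z) i (demand μd σd z - x₀) -
            A.logBid (logFuel μ a b z) i.rev y₀)))
      (Real.exp (A.eta σ σd) * A.bidBoth μd (meanFuel μ a b) *
        Phi2Diff ((u - μd) / σd - A.gamma * σd) ((l - μd) / σd - A.gamma * σd)
          ((A.R σ (meanFuel μ a b) i (μd - x₀) y₀ + A.alpha i.rev * σ ^ 2
            - A.gamma * A.m i * σd ^ 2) / (ε * A.sigmaD σ σd i))
          (A.m i * σd / (ε * A.sigmaD σ σd i))) := by
  have hα := alpha_add_alpha_rev (A := A) 0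
  rw [show (0 : Fin 2).rev = 1 from rfl] at hα
  have hαi := alpha_add_alpha_rev (A := A) i
  have hε2 : ε ^ 2 = 1 := by rcases hε with rfl | rfl <;> norm_num
  have hε0 : ε ≠ 0 := by rintro rfl; norm_num at hε2
  have hdiv (x : ℝ) : ε * x / A.sigmaD σ σd i = x / (ε * A.sigmaD σ σd i) := by
    have := (sigmaD_pos (A := A) (σd := σd) hσ i).ne'
    field_simp
    rw [hε2, one_mul]
  have hF : A.bidBoth μd (meanFuel μ a b) =
      Real.exp ((μ 0 + (a 0 ^ 2 + b ^ 2) / 2) * A.alpha 0 + (μ 1 + (a 1 ^ 2 + b ^ 2) / 2) * A.alpha 1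
        + (A.beta + A.gamma * μd)) := by
    rw [bidBoth, meanFuel, meanFuel, ← Real.exp_mul, ← Real.exp_mul, ← Real.exp_add,
      ← Real.exp_add]
  have hp : A.alpha 0 * a 0 + A.alpha 1 * a 1 = A.alpha i * a i + A.alpha i.rev * a i.rev := by
    rw [← sum_fin_two_rev (fun i => A.alpha i * a i) i, Fin.sum_univ_two]
  rw [hF, ← Real.exp_add]
  refine integralEq_cell (p := A.alpha 0 * a 0 + A.alpha 1 * a 1) (q := A.gamma * σd)
    (P := A.alpha 0 * μ 0 + A.alpha 1 * μ 1 + A.beta + A.gamma * μd)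
    (b := b) (c := ε * (a i - a i.rev)) (d := ε * (A.m i * σd))
    (r := -ε * (μ i + A.k i + A.m i * (μd - x₀) - (μ i.rev + A.k i.rev + A.m i.rev * y₀)))
    (fun z => ?_) (fun z => rfl) (fun z => ?_) hlu hσd (sigmaD_pos hσ i) ?_ ?_ rfl rfl ?_ (hdiv _)
  · simp only [logBidBoth, logFuel, demand]
    linear_combination b * z.1.2 * hα
  · simp only [logBid, logFuel, demand]; ring
  · rw [sq_sigmaD, mul_pow, mul_pow, mul_pow, hε2, sq_sub_rev hσa]; ring
  -- The term `-α₀α₁σ²` in `eta` is the Jensen gap between the square of the weighted mean of the `a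
  -- i` and the weighted mean of their squares.
  · rw [eta, hσa, eq_sub_of_add_eq' hα]
    ring
  -- Here the shift is `p = a i - α_j (a i - a j)` with `j = i.rev`, whose deviation from `a i`
  -- produces the extra `α_j σ²` next to `R`.
  · rw [← hdiv, R_meanFuel hσa, ← sq_sub_rev hσa i, hp, eq_sub_of_add_eq' hαi]
    ring_nf

lemma integralEq_edge_low (hσ : 0 < σ) (hσd : 0 < σd) (hσa : σ = a 1 - a 0) (i : Fin 2) :
    IntegralEq stdNormal₃ (fun z => if demand μd σd z ≤ 0 ∧ A.logBid (logFuel μ a b z) i 0 -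
        A.logBid (logFuel μ a b z) i.rev 0 ≤ 0 then
          Real.exp (A.logBid (logFuel μ a b z) i 0) else 0)
      (Phi1 (-μd / σd) * (A.bid i 0 (meanFuel μ a b i) *
        Phi1 (A.R σ (meanFuel μ a b) i 0 0 / σ))) := by
  rw [bid, meanFuel, ← Real.exp_add]
  refine integralEq_edge (P := μ i + A.k i) (p := a i) (b := b) (c := a i - a i.rev) (D := Set.Iic 0)
    (r := -(μ i + A.k i - (μ i.rev + A.k i.rev))) (μd := μd) (σd := σd)
    measurableSet_Iic (fun z => ?_) (fun z => Iff.rfl) ?_ (fun z => ?_) hσ (sq_sub_rev hσa i) ?_ ?_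
  · simp only [logBid, logFuel]; ring
  · rw [Phi1_eq]
    congr 1
    ext w
    simp only [Set.mem_ofPred_eq, Set.mem_Iic, le_div_iff₀ hσd]
    constructor <;> intro h <;> linarith
  · simp only [logBid, logFuel]; ring
  · ring
  · rw [R_meanFuel hσa]
    ring_nf

lemma integralEq_edge_high (hσ : 0 < σ) (hσd : 0 < σd) (hσa : σ = a 1 - a 0) (ξ : ℝ) (i : Fin 2) :
    IntegralEq stdNormal₃ (fun z => if ξ < demand μd σd z ∧
        -(A.logBid (logFuel μ a b z) i (A.cap i) -
          A.logBid (logFuel μ a b z) i.rev (A.cap i.rev)) ≤ 0 then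
          Real.exp (A.logBid (logFuel μ a b z) i (A.cap i)) else 0)
      (Phi1 ((μd - ξ) / σd) * (A.bid i (A.cap i) (meanFuel μ a b i) *
        Phi1 (-A.R σ (meanFuel μ a b) i (A.cap i) (A.cap i.rev) / σ))) := by
  rw [bid, meanFuel, ← Real.exp_add]
  refine integralEq_edge (P := μ i + A.k i + A.m i * A.cap i) (p := a i) (b := b)
    (c := -(a i - a i.rev)) (D := Set.Ioi ξ)
    (r := μ i + A.k i + A.m i * A.cap i - (μ i.rev + A.k i.rev + A.m i.rev * A.cap i.rev))
    (μd := μd) (σd := σd)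
    measurableSet_Ioi (fun z => ?_) (fun z => Iff.rfl) ?_ (fun z => ?_) hσ
    (by rw [neg_sq, sq_sub_rev hσa i]) ?_ ?_
  · simp only [logBid, logFuel]; ring
  · rw [← neg_sub, neg_div, ← stdNormal_real_Ioi]
    congr 1
    ext w
    simp only [Set.mem_ofPred_eq, Set.mem_Ioi, div_lt_iff₀ hσd]
    constructor <;> intro h <;> linarith
  · simp only [logBid, logFuel]; ring
  · ring
  · rw [R_meanFuel hσa]
    ring_nf

theorem integralEq_priceFormula (hσ : 0 < σ) (hσd : 0 < σd) (hσa : σ = a 1 - a 0)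
    (iplus : Fin 2) :
    IntegralEq stdNormal₃
      (fun z => A.priceFormula iplus (logFuel μ a b z) (demand μd σd z))
      (A.forward iplus σ μd σd (meanFuel μ a b)) := by
  have hξ (i : Fin 2) : A.cap i.rev ≤ A.totalCap := by
    rw [totalCap_eq i]; linarith [A.cap_pos i]
  have hδ (i : Fin 2) : (if i = iplus then (-1 : ℝ) else 1) = 1 ∨
      (if i = iplus then (-1 : ℝ) else 1) = -1 := by
    split_ifs <;> simp
  have h1 (i : Fin 2) := integralEq_cell_alone (A := A) (μ := μ) (b := b) (μd := μd) hσ hσd hσa i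
    (ε := 1) (by norm_num) 0 0 (A.cap_pos i).le
  have h2 (i : Fin 2) := integralEq_cell_alone (A := A) (μ := μ) (b := b) (μd := μd) hσ hσd hσa i
    (ε := -1) (by norm_num) (A.cap i.rev) (A.cap i.rev) (hξ i)
  have h3 (i : Fin 2) := integralEq_cell_both (A := A) (μ := μ) (b := b) (μd := μd) hσ hσd hσa i
    (hδ i) 0 0 (A.cap_pos i).le
  have h4 (i : Fin 2) := integralEq_cell_both (A := A) (μ := μ) (b := b) (μd := μd) hσ hσd hσa i
    (hδ i) (A.cap i.rev) (A.cap i.rev) (hξ i)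
  have h5 := integralEq_edge_low (A := A) (μ := μ) (b := b) (μd := μd) hσ hσd hσa
  have h6 := integralEq_edge_high (A := A) (μ := μ) (b := b) (μd := μd) hσ hσd hσa A.totalCap
  have h := (((IntegralEq.sum fun i => (h1 i).add (h2 i)).add
    (IntegralEq.sum fun i => ((h3 i).neg.add (h4 i)).const_mul (if i = iplus then -1 else 1))).add
    (IntegralEq.sum h5)).add (IntegralEq.sum h6)
  simp only [sub_zero] at h
  convert h using 1
  · rfl
  simp only [forward, Finset.mul_sum, one_mul, zero_sub]
  congr 1
  congr 1
  congr 1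
  · refine Finset.sum_congr rfl fun i _ => ?_
    ring_nf
  · refine Finset.sum_congr rfl fun i _ => ?_
    ring_nf

end Stack

/-! ### The conditional law in terms of standard normal factors -/

lemma gaussianReal_eq_map_stdNormal (μd σd : ℝ) :
    gaussianReal μd (σd ^ 2).toNNReal = stdNormal.map (fun z => μd + σd * z) := by
  have h : (fun z => μd + σd * z) = (fun z => μd + z) ∘ (fun z => σd * z) := rfl
  rw [h, ← Measure.map_map (by fun_prop) (by fun_prop), gaussianReal_map_const_mul,
    gaussianReal_map_const_add, mul_zero, zero_add, mul_one]
  congr 1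
  exact Real.toNNReal_of_nonneg (sq_nonneg _)

/-- Two jointly normal variables share the component that is orthogonal to their difference. -/
lemma exists_map_stdNormal₃_eq (s : Fin 2 → ℝ) {ρ σ : ℝ} (hρ : |ρ| ≤ 1)
    (hσ : σ ^ 2 = s 0 ^ 2 - 2 * ρ * s 0 * s 1 + s 1 ^ 2) (hσpos : 0 < σ) (σd : ℝ) :
    ∃ (a : Fin 2 → ℝ) (b : ℝ), σ = a 1 - a 0 ∧ ∀ (μ : Fin 2 → ℝ) (μd : ℝ),
      (bivariateNormal μ s ρ).prod (gaussianReal μd (σd ^ 2).toNNReal) =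
        stdNormal₃.map fun z => ((WithLp.toLp 2 (Stack.logFuel μ a b z) : EuclideanSpace ℝ (Fin 2)),
          Stack.demand μd σd z) := by
  -- `a i` is the covariance of the log price `i` with the log price difference, divided by `σ`. The
  -- residual variance `s i ^ 2 - a i ^ 2` is the same for both fuels and equals `b²`.
  set a : Fin 2 → ℝ := ![(ρ * s 0 * s 1 - s 0 ^ 2) / σ, (s 1 ^ 2 - ρ * s 0 * s 1) / σ]
  set b : ℝ := s 0 * s 1 * √(1 - ρ ^ 2) / σ with hb
  have hρ2 : √(1 - ρ ^ 2) ^ 2 = 1 - ρ ^ 2 :=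
    Real.sq_sqrt (by have := sq_le_one_iff_abs_le_one ρ |>.2 hρ; linarith)
  have hσ0 := hσpos.ne'
  have ha0 : a 0 = (ρ * s 0 * s 1 - s 0 ^ 2) / σ := rfl
  have ha1 : a 1 = (s 1 ^ 2 - ρ * s 0 * s 1) / σ := rfl
  have h00 : a 0 * a 0 + b * b = s 0 ^ 2 := by
    rw [ha0, hb]
    field_simp
    rw [hρ2, hσ]; ring
  have h01 : a 0 * a 1 + b * b = ρ * s 0 * s 1 := by
    rw [ha0, ha1, hb]
    field_simp
    rw [hρ2, hσ]; ring
  have h11 : a 1 * a 1 + b * b = s 1 ^ 2 := by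
    rw [ha1, hb]
    field_simp
    rw [hρ2, hσ]; ring
  refine ⟨a, b, ?_, fun μ μd => ?_⟩
  · rw [ha0, ha1]
    field_simp
    linarith
  have hcov : (!![s 0 ^ 2, ρ * s 0 * s 1; ρ * s 0 * s 1, s 1 ^ 2] : Matrix (Fin 2) (Fin 2) ℝ) =
      Matrix.vecMulVec a a + Matrix.vecMulVec (fun _ => b) (fun _ => b) := by
    rw [← h00, ← h01, ← h11]
    ext i j
    fin_cases i <;> fin_cases j <;> simp [Matrix.vecMulVec_apply, mul_comm]
  rw [bivariateNormal, hcov, ← map_stdNormal_prod, gaussianReal_eq_map_stdNormal,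
    Measure.map_prod_map _ _ (by fun_prop) (by fun_prop)]
  rfl

lemma measurable_logFuel_demand (μ a : Fin 2 → ℝ) (b μd σd : ℝ) :
    Measurable fun z => ((WithLp.toLp 2 (Stack.logFuel μ a b z) : EuclideanSpace ℝ (Fin 2)),
      Stack.demand μd σd z) := by
  unfold Stack.logFuel Stack.demand
  fun_prop

lemma measurableSet_eq_sub_add (w r : ℝ) :
    MeasurableSet {z : EuclideanSpace ℝ (Fin 2) × ℝ | z.1 1 - z.1 0 + w * z.2 = r} :=
  measurableSet_eq_fun (by fun_prop) (by fun_prop)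

/-- With the demand factor fixed, the equation pins the first factor to one point, because the
difference of log prices has slope `σ ≠ 0` in it. -/
lemma map_stdNormal₃_eq_zero {σ : ℝ} (hσ : 0 < σ) {a : Fin 2 → ℝ} (hσa : σ = a 1 - a 0)
    (μ : Fin 2 → ℝ) (b μd σd w r : ℝ) :
    (stdNormal₃.map fun z => ((WithLp.toLp 2 (Stack.logFuel μ a b z) : EuclideanSpace ℝ (Fin 2)),
      Stack.demand μd σd z)) {z | z.1 1 - z.1 0 + w * z.2 = r} = 0 := by
  have hm := measurable_logFuel_demand μ a b μd σd
  have := nullSingletonClass_gaussianReal (μ := 0) (v := 1) one_ne_zero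
  rw [Measure.map_apply hm (measurableSet_eq_sub_add w r),
    Measure.prod_apply_symm (hm (measurableSet_eq_sub_add w r))]
  refine lintegral_eq_zero_of_ae_eq_zero (Filter.Eventually.of_forall fun y => ?_)
  refine measure_mono_null (t := {(r - w * (μd + σd * y) - μ 1 + μ 0) / σ} ×ˢ Set.univ) ?_ ?_
  · rintro x hx
    simp only [Set.mem_preimage, Set.mem_ofPred_eq, Stack.logFuel, Stack.demand] at hx
    simp only [Set.mem_prod, Set.mem_singleton_iff, Set.mem_univ, and_true]
    rw [eq_div_iff hσ.ne', hσa]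
    linarith
  · rw [Measure.prod_prod, measure_singleton, zero_mul]

/-! ### Measurability and integrability of the price -/

/-- If the offers at `p` sum to less than `ξ ≤ ∑ cap`, some fuel offers less than its capacity, so
`p` lies below its highest bid. -/
lemma marketBid_mem_Icc {ι : Type*} [Fintype ι] [Nonempty ι] {b : ι → ℝ → ℝ} {cap : ι → ℝ}
    (hb : ∀ i, StrictMono (b i)) (hcap : ∀ i, 0 ≤ cap i) (hb0 : ∀ i, 0 ≤ b i 0) {ξ : ℝ}
    (hξ : ξ ≤ ∑ i, cap i) : marketBid b cap ξ ∈ Set.Icc 0 (∑ i, b i (cap i)) := by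
  have hbc (i : ι) : 0 ≤ b i (cap i) := (hb0 i).trans ((hb i).monotone (hcap i))
  have hle (i : ι) : b i (cap i) ≤ ∑ i, b i (cap i) :=
    Finset.single_le_sum (fun i _ => hbc i) (Finset.mem_univ i)
  have hub : ∀ p ∈ insert (⨅ i, b i 0) {p | ∑ i, bidInverse (b i) (cap i) p < ξ},
      p ≤ ∑ i, b i (cap i) := by
    rintro p (rfl | hp)
    · obtain ⟨i⟩ := ‹Nonempty ι›
      exact ((ciInf_le (Set.finite_range _).bddBelow i).trans
        ((hb i).monotone (hcap i))).trans (hle i)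
    · obtain ⟨i, -, hi⟩ := Finset.exists_lt_of_sum_lt (hp.trans_le hξ)
      refine le_trans (not_lt.1 fun h => ?_) (hle i)
      exact hi.not_ge (le_bidInverse (hb i) le_rfl h.le)
  exact ⟨(le_ciInf hb0).trans (le_csSup ⟨_, hub⟩ (Set.mem_insert _ _)),
    csSup_le (Set.insert_nonempty _ _) hub⟩

namespace Stack

variable {A : Stack}

lemma price_mem_Icc {s : Fin 2 → ℝ} (hs : ∀ i, 0 < s i) {ξ : ℝ} (hξ : ξ ≤ A.totalCap) :
    A.price ξ s ∈ Set.Icc 0 (∑ i, A.bid i (A.cap i) (s i)) := by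
  refine marketBid_mem_Icc (fun i x x' hx => ?_) (fun i => (A.cap_pos i).le) (fun i => ?_) hξ
  · have := A.m_pos i
    have := hs i
    simp only [bid]
    gcongr
  · exact mul_nonneg (hs i).le (Real.exp_pos _).le

lemma measurable_cell {Z : Type*} [MeasurableSpace Z] {L x R : Z → ℝ} {l u : ℝ}
    (hL : Measurable L) (hx : Measurable x) (hR : Measurable R) :
    Measurable fun z => cell (L z) l u (x z) (R z) := by
  refine Measurable.ite ?_ (by fun_prop) (by fun_prop)
  measurability

lemma measurable_priceFormula (A : Stack) (iplus : Fin 2) :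
    Measurable fun z : EuclideanSpace ℝ (Fin 2) × ℝ => A.priceFormula iplus z.1 z.2 := by
  have hh (i : Fin 2) (c : ℝ) : Measurable fun z : EuclideanSpace ℝ (Fin 2) × ℝ =>
      A.logBid z.1 i (z.2 - c) := by unfold logBid; fun_prop
  have hx (i : Fin 2) : Measurable fun z : EuclideanSpace ℝ (Fin 2) × ℝ =>
      A.logBid z.1 i z.2 := by unfold logBid; fun_prop
  have hc (i : Fin 2) (c : ℝ) : Measurable fun z : EuclideanSpace ℝ (Fin 2) × ℝ =>
      A.logBid z.1 i c := by unfold logBid; fun_prop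
  have hb : Measurable fun z : EuclideanSpace ℝ (Fin 2) × ℝ => A.logBidBoth z.1 z.2 := by
    unfold logBidBoth; fun_prop
  unfold priceFormula
  refine (((Finset.measurable_fun_sum _ fun i _ => ?_).add
    (Finset.measurable_fun_sum _ fun i _ => ?_)).add
    (Finset.measurable_fun_sum _ fun i _ => ?_)).add (Finset.measurable_fun_sum _ fun i _ => ?_)
  · exact (measurable_cell (hx _) measurable_snd (((hx _).sub (hc _ _)).const_mul _)).add
      (measurable_cell (hh _ _) measurable_snd (((hh _ _).sub (hc _ _)).const_mul _))
  · exact ((measurable_cell hb measurable_snd (((hx _).sub (hc _ _)).const_mul _)).neg.add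
      (measurable_cell hb measurable_snd (((hh _ _).sub (hc _ _)).const_mul _))).const_mul _
  · refine Measurable.ite ?_ (hc _ _).exp measurable_const
    exact (measurableSet_le measurable_snd measurable_const).inter
      (measurableSet_le ((hc _ _).sub (hc _ _)) measurable_const)
  · refine Measurable.ite ?_ (hc _ _).exp measurable_const
    exact (measurableSet_lt measurable_const measurable_snd).inter
      (measurableSet_le ((hc _ _).sub (hc _ _)).neg measurable_const)

/-- Every tie is an equation `y 1 - y 0 + w * x = r`, with `w` equal to `-m 0`, `m 1` or `0`. -/
lemma ae_noTies {Ω : Type*} {mΩ : MeasurableSpace Ω} {Q : Measure Ω} {y : Ω → Fin 2 → ℝ}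
    {x : Ω → ℝ} (h : ∀ w r : ℝ, ∀ᵐ ω ∂Q, y ω 1 - y ω 0 + w * x ω ≠ r) :
    ∀ᵐ ω ∂Q, A.NoTies (y ω) (x ω) := by
  filter_upwards [h (-A.m 0) (A.k 0 - A.k 1), h (A.m 1) (A.k 0 - A.k 1),
    h (-A.m 0) (A.k 0 - A.m 0 * A.cap 1 - A.k 1 - A.m 1 * A.cap 1),
    h (A.m 1) (A.k 0 + A.m 0 * A.cap 0 - A.k 1 + A.m 1 * A.cap 0),
    h 0 (A.k 0 - A.k 1), h 0 (A.k 0 + A.m 0 * A.cap 0 - A.k 1 - A.m 1 * A.cap 1)]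
    with ω h1 h2 h3 h4 h5 h6
  have e0 : (0 : Fin 2).rev = 1 := rfl
  have e1 : (1 : Fin 2).rev = 0 := rfl
  refine ⟨Fin.forall_fin_two.2 ⟨?_, ?_⟩, Fin.forall_fin_two.2 ⟨?_, ?_⟩, ?_, ?_⟩ <;>
    simp only [e0, e1, logBid] <;> intro h
  · exact h1 (by linarith)
  · exact h2 (by linarith)
  · exact h3 (by linarith)
  · exact h4 (by linarith)
  · exact h5 (by linarith)
  · exact h6 (by linarith)

end Stack

lemma integralEq_exp_logFuel (μ a : Fin 2 → ℝ) (b : ℝ) (i : Fin 2) :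
    IntegralEq stdNormal₃ (fun z => Real.exp (Stack.logFuel μ a b z i))
      (Stack.meanFuel μ a b i) := by
  have := integralEq_exp_of_eq_indicator (f := fun z => Real.exp (Stack.logFuel μ a b z i)) (P := μ i)
    (p := a i) (b := b) (q := 0) (B := Set.univ) MeasurableSet.univ rfl
    (fun z => by simp [Stack.logFuel])
  simpa [Stack.meanFuel] using this

end BidStack

end

/-! ### The forward price formula -/

theorem mainTheorem2 {Ω : Type*} {mΩ : MeasurableSpace Ω}
    (Q : Measure Ω) [IsProbabilityMeasure Q]
    -- the market filtration, the current date and the maturity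
    (ℱ : Filtration ℝ≥0 mΩ) (t T : ℝ≥0) (htT : t ≤ T)
    -- the bid stack, and a fuel of largest capacity
    (A : BidStack.Stack) (iplus : Fin 2) (hplus : ∀ i, A.cap i ≤ A.cap iplus)
    -- the fuel prices, the demand, and the untruncated demand
    (S : Fin 2 → ℝ≥0 → Ω → ℝ) (D X : ℝ≥0 → Ω → ℝ)
    (hS : ∀ i, Adapted ℱ (S i)) (hD : Adapted ℱ D) (hX : Adapted ℱ X)
    (hSpos : ∀ i, ∀ᵐ ω ∂Q, 0 < S i T ω)
    (hSint : ∀ i, Integrable (S i T) Q)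
    (hDX : ∀ᵐ ω ∂Q, D T ω = max 0 (min A.totalCap (X T ω)))
    -- given `ℱ t`, the log fuel prices at `T` are bivariate normal, the untruncated demand at `T`
    -- is normal, and the two are independent
    (μ : Fin 2 → Ω → ℝ) (μd : Ω → ℝ)
    (hμ : ∀ i, Measurable[ℱ t] (μ i)) (hμd : Measurable[ℱ t] μd)
    (s : Fin 2 → ℝ) (ρ σ σd : ℝ) (hs : ∀ i, 0 ≤ s i) (hρ : |ρ| ≤ 1)
    (hσ : σ ^ 2 = s 0 ^ 2 - 2 * ρ * s 0 * s 1 + s 1 ^ 2) (hσpos : 0 < σ) (hσd : 0 < σd)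
    (hlaw : BidStack.HasCondLaw Q (ℱ t)
      (fun ω => ((WithLp.toLp 2 (fun i => Real.log (S i T ω)) : EuclideanSpace ℝ (Fin 2)), X T ω))
      (fun ω => (BidStack.bivariateNormal (fun i => μ i ω) s ρ).prod
        (gaussianReal (μd ω) (σd ^ 2).toNNReal))) :
    Integrable (fun ω => A.price (D T ω) (fun i => S i T ω)) Q ∧
    Q[fun ω => A.price (D T ω) (fun i => S i T ω) | ℱ t] =ᵐ[Q]
      fun ω => A.forward iplus σ (μd ω) σd (fun i => (Q[S i T | ℱ t]) ω) := by
  -- `a` and `b` depend only on the constants `s`, `ρ`, `σ`, so they serve all `ω` at once although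
  -- the means are random.
  obtain ⟨a, b, hσa, hmap⟩ := BidStack.exists_map_stdNormal₃_eq s hρ hσ hσpos σd
  have hm : ℱ t ≤ mΩ := ℱ.le t
  have hSm (i : Fin 2) : Measurable (S i T) := (hS i T).mono (ℱ.le T) le_rfl
  have hXm : Measurable (X T) := (hX T).mono (ℱ.le T) le_rfl
  set Y : Ω → EuclideanSpace ℝ (Fin 2) × ℝ := fun ω =>
    (WithLp.toLp 2 (fun i => Real.log (S i T ω)), X T ω)
  have hY : Measurable Y := by fun_prop
  set ν : Ω → Measure (EuclideanSpace ℝ (Fin 2) × ℝ) := fun ω =>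
    (BidStack.bivariateNormal (fun i => μ i ω) s ρ).prod
      (gaussianReal (μd ω) (σd ^ 2).toNNReal)
  have hνmap (ω : Ω) : ν ω = BidStack.stdNormal₃.map fun z =>
      ((WithLp.toLp 2 (BidStack.Stack.logFuel (fun i => μ i ω) a b z) : EuclideanSpace ℝ (Fin 2)),
        BidStack.Stack.demand (μd ω) σd z) := hmap (fun i => μ i ω) (μd ω)
  have hνprob (ω : Ω) : IsProbabilityMeasure (ν ω) := by
    rw [hνmap]
    exact Measure.isProbabilityMeasure_map
      (BidStack.measurable_logFuel_demand _ _ _ _ _).aemeasurable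
  have hpos : ∀ᵐ ω ∂Q, ∀ i, 0 < S i T ω := ae_all_iff.2 hSpos
  have hties : ∀ᵐ ω ∂Q, A.NoTies (fun i => Real.log (S i T ω)) (X T ω) :=
    BidStack.Stack.ae_noTies fun w r =>
      hlaw.ae_notMem hm hY (BidStack.measurableSet_eq_sub_add w r) fun ω => by
        rw [hνmap]
        exact BidStack.map_stdNormal₃_eq_zero hσpos hσa _ _ _ _ _ _
  have hprice : (fun ω => A.price (D T ω) (fun i => S i T ω)) =ᵐ[Q]
      fun ω => A.priceFormula iplus (Y ω).1 (Y ω).2 := by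
    filter_upwards [hpos, hties, hDX] with ω h1 h2 h3
    have := BidStack.Stack.price_eq_priceFormula hplus h2
    simp only [Real.exp_log (h1 _)] at this
    rw [h3, this]
  have hfm := BidStack.Stack.measurable_priceFormula A iplus
  have hint : Integrable (fun ω => A.price (D T ω) (fun i => S i T ω)) Q := by
    -- The dominating function is linear in the fuel prices. Measurability of the price comes from
    -- its almost sure equality with `priceFormula`.
    refine Integrable.mono' (g := fun ω => ∑ i, A.bid i (A.cap i) (S i T ω))
      (integrable_finsetSum _ fun i _ => (hSint i).mul_const _)
      ((hfm.comp hY).aestronglyMeasurable.congr hprice.symm) ?_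
    filter_upwards [hpos, hDX] with ω h1 h2
    have h3 : D T ω ≤ A.totalCap := by
      rw [h2]
      exact max_le BidStack.Stack.totalCap_pos.le (min_le_left _ _)
    have h4 := BidStack.Stack.price_mem_Icc h1 h3
    rw [Real.norm_of_nonneg h4.1]
    exact h4.2
  -- The conditional law of the log prices also gives the fuel forward prices, as lognormal means.
  have hF (i : Fin 2) : Q[S i T | ℱ t] =ᵐ[Q] fun ω =>
      BidStack.Stack.meanFuel (fun i => μ i ω) a b i := by
    have h1 : S i T =ᵐ[Q] fun ω => Real.exp ((Y ω).1 i) := by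
      filter_upwards [hSpos i] with ω h
      exact (Real.exp_log h).symm
    have hg : Measurable fun z : EuclideanSpace ℝ (Fin 2) × ℝ => Real.exp (z.1 i) := by fun_prop
    refine (condExp_congr_ae h1).trans
      ((hlaw.condExp_comp_ae_eq hm hY hg ((hSint i).congr h1)).trans ?_)
    refine Filter.Eventually.of_forall fun ω => ?_
    simp only
    rw [hνmap, integral_map (BidStack.measurable_logFuel_demand _ _ _ _ _).aemeasurable
      hg.aestronglyMeasurable]
    exact (BidStack.integralEq_exp_logFuel (fun i => μ i ω) a b i).2
  refine ⟨hint, (condExp_congr_ae hprice).trans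
    ((hlaw.condExp_comp_ae_eq hm hY hfm (hint.congr hprice)).trans ?_)⟩
  filter_upwards [hF 0, hF 1] with ω h0 h1
  have hFω : (fun i => (Q[S i T | ℱ t]) ω) = BidStack.Stack.meanFuel (fun i => μ i ω) a b :=
    funext (Fin.forall_fin_two.2 ⟨h0, h1⟩)
  rw [hFω, hνmap, integral_map (BidStack.measurable_logFuel_demand _ _ _ _ _).aemeasurable
    hfm.aestronglyMeasurable]
  exact (BidStack.Stack.integralEq_priceFormula hσpos hσd hσa iplus).2
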